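/- **Model.** There are $n$ processes $1,\dots,n$, each with a local dispatcher $d_i$ (processes and dispatchers are the *agents*), and a set of shared variables. A TSO state consists of a memory $m$ and a FIFO store buffer for each process. A process $i$ may write, $W[x,v]$ (append $\langle x,v\rangle$ to its buffer); read, $R[x]$ (the newest entry for $x$ in its own buffer if there is one, an event $RfB$; otherwise $m(x)$, an event $RfM$); fence, $F$ (enabled only if its buffer is empty); read-modify-write, $RMW[x,v_{exp},v_{new}]$ (enabled only if its buffer is empty and $m(x)=v_{exp}$; sets $m(x):=v_{new}$); or perform an internal action, such as returning from its pending operation. The action $prop$ of $d_i$, enabled if $i$'s buffer is nonempty, removes the oldest entry $\langle x,v\rangle$ of $i$'s buffer and sets $m(x):=v$. The *memory accesses* of $x$ are the events $RfM$, $RMW$ and $prop$ on $x$. A local state is the list of the records of the process's past non-null actions (a read is recorded with its value, but without distinguishing $RfB$ from $RfM$) and of the invocations it received. A *run* of a protocol $P$ (a nonempty set of allowed actions, possibly including the null action, for every process and local state, together with an initial memory) is an infinite sequence of global states $r(0),r(1),\dots$, starting with empty buffers and empty local states. Here $r(t+1)$ results from $r(t)$ by a joint action: an action (or null) of every process, allowed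 by $P$ and enabled at $r(t)$; $prop$ or null for every dispatcher, enabled at $r(t)$; and at most one operation invocation by the environment at each process that has no pending operation. These are executed in this order. No two actions of a joint action may conflict; two actions conflict if both are memory accesses of the same variable, not both are $RfM$, and they are not a $prop$ of $d_i$ together with an $RfM$ of $i$. The action of agent $b$ in this joint action is the action at the *node* $\langle b,t\rangle$. The relation *occurs-before*, $\rightsquigarrow_r$, is the least transitive relation on nodes such that for all $t<t'$: 1. $\langle b,t\rangle\rightsquigarrow_r\langle b,t'\rangle$ for every agent $b$; 2. $\langle i,t\rangle\rightsquigarrow_r\langle d_i,t'\rangle$ if an item written, or read from the buffer, at $\langle i,t\rangle$ is propagated at $\langle d_i,t'\rangle$; 3. $\langle b,t\rangle\rightsquigarrow_r\langle c,t'\rangle$ if the actions at both nodes are memory accesses of the same variable, except if both are $RfM$, or if $b=d_i$, $c=i$, the first is a $prop$ and the second an $RfM$; 4. $\langle d_i,t\rangle\rightsquigarrow_r\langle i,t'\rangle$ if the action at $\langle d_i,t\rangle$ is a $prop$ and the one at $\langle i,t'\rangle$ is an $F$ or $RMW$. For an operation $X$ of process $i$ that is invoked in the step from $r(t)$ to $r(t+1)$,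 let $X.s=\langle i,t\rangle$; if $X$ completes, and its return is performed in the step from $r(t'-1)$ to $r(t')$, let $X.e=\langle i,t'\rangle$. Operation $X$ *precedes* $Y$, $X<_rY$, if $X$ completes and the time of $X.e$ is smaller than the time of $Y.s$. Operation $X$ *occurs before* a completed operation $Y$, $X\rightsquigarrow_rY$, if $X.s\rightsquigarrow_r Y.e$. The *snapshot* object over a value set $W$ has operations $\mathrm{update}(w)$, $w\in W$, returning $\mathtt{ack}$, and $\mathrm{scan}$, returning a vector $V$ indexed by the processes, where $V(k)$ is the value of the last preceding update by process $k$, or $\bot\notin W$ if there is none. Only runs in which no process is asked to update with the same value more than once are considered. A protocol is a *linearizable snapshot implementation* if, for each such run, the history up to each time is linearizable: after completing some of the pending operations with responses and discarding the other pending ones, its operations can be arranged in a sequence that satisfies the sequential specification, preserves the order of operations of each process, and extends $<_r$. **Theorem (update to scan).** Let $r$ be a run of a linearizable snapshot implementation in TSO in which no process updates with the same value more than once, and in which no process reads an item from its buffer in the same round in which its dispatcher propagates that very item. (a) If $\mathrm{update}_i(v)<_r\mathrm{scan}_j$ and $\mathrm{scan}_j$ completes in $r$, then $\mathrm{update}_i(v)\rightsquigarrow_r\mathrm{scan}_j$.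 (b) If $\mathrm{scan}_i<_r\mathrm{update}_j(v)$ and $\mathrm{update}_j(v)$ completes in $r$, then $\mathrm{scan}_i\rightsquigarrow_r\mathrm{update}_j(v)$. -/

import Mathlib

namespace TSO

/-! ### Actions, events, states -/

/-- Non-null actions of a process; the null action is `none : Option (Act ..)`.
`ret ρ` is the response of the pending operation with result `ρ`, and `internal` covers all
other internal actions. -/
inductive Act (Var Val Lab Resp : Type*) where
  | read (x : Var)
  | write (x : Var) (v : Val)
  | fence
  | rmw (x : Var) (vexp vnew : Val)
  | internal (a : Lab)
  | ret (ρ : Resp)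

/-- Records kept in local states. A read is recorded without telling whether the value came from
the buffer or from memory. -/
inductive Record (Var Val Lab Op Resp : Type*) where
  | read (x : Var) (v : Val)
  | write (x : Var) (v : Val)
  | fence
  | rmw (x : Var) (vexp vnew : Val)
  | internal (a : Lab)
  | ret (ρ : Resp)
  | invoke (o : Op)

/-- Store buffer entry `⟨x, v⟩` of a process, with its tag: `idx = k` if the entry was created by
the `k`-th write of that process, counting from zero. Tags are bookkeeping only; they influence
neither the actions available nor the values read. -/
structure Item (Var Val : Type*) where
  var : Var
  val : Val
  idx : ℕ

/-- A TSO state: main memory and one store buffer per process, oldest entry first. -/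
structure Store (n : ℕ) (Var Val : Type*) where
  mem : Var → Val
  buf : Fin n → List (Item Var Val)

/-- The local state of a process is the list of its records so far, oldest first. -/
abbrev LocalState (Var Val Lab Op Resp : Type*) := List (Record Var Val Lab Op Resp)

/-- A global state: a TSO state and a local state for every process. -/
structure GState (n : ℕ) (Var Val Lab Op Resp : Type*) where
  store : Store n Var Val
  loc : Fin n → LocalState Var Val Lab Op Resp

/-- Agents: processes and their local dispatchers. -/
inductive Agent (n : ℕ) where
  | proc (i : Fin n)
  | disp (i : Fin n)

/-- The process whose buffer an agent works on. -/
def Agent.owner {n : ℕ} : Agent n → Fin n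
  | .proc i => i
  | .disp i => i

/-- A joint action: an action (or null) for every process, `prop` or null for every dispatcher,
and at most one invocation for every process by the environment. -/
structure JointAction (n : ℕ) (Var Val Lab Op Resp : Type*) where
  act : Fin n → Option (Act Var Val Lab Resp)
  prop : Fin n → Bool
  inv : Fin n → Option Op

/-- Events, i.e. actions taking place. The argument `k` is the index part of the tag. -/
inductive Event (Var Val Lab Resp : Type*) where
  | write (x : Var) (v : Val) (k : ℕ)
  | rfb (x : Var) (v : Val) (k : ℕ)
  | rfm (x : Var) (v : Val)
  | fence
  | rmw (x : Var) (vexp vnew : Val)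
  | prop (x : Var) (v : Val) (k : ℕ)
  | internal (a : Lab)
  | ret (ρ : Resp)

namespace Event

variable {Var Val Lab Op Resp : Type*}

/-- The variable of which the event is a memory access, if any. -/
def access : Event Var Val Lab Resp → Option Var
  | rfm x _ => some x
  | rmw x _ _ => some x
  | prop x _ _ => some x
  | _ => none

def IsRfM : Event Var Val Lab Resp → Prop
  | rfm _ _ => True
  | _ => False

def IsProp : Event Var Val Lab Resp → Prop
  | prop _ _ _ => True
  | _ => False

/-- A fence or a read-modify-write. -/
def IsSync : Event Var Val Lab Resp → Prop
  | fence => True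
  | rmw _ _ _ => True
  | _ => False

/-- What a process records in its local state when the event takes place. -/
def record : Event Var Val Lab Resp → List (Record Var Val Lab Op Resp)
  | write x v _ => [.write x v]
  | rfb x v _ => [.read x v]
  | rfm x v => [.read x v]
  | fence => [.fence]
  | rmw x ve vn => [.rmw x ve vn]
  | prop _ _ _ => []
  | internal a => [.internal a]
  | ret ρ => [.ret ρ]

end Event

section Semantics

variable {n : ℕ} {Var Val Lab Op Resp : Type*} [DecidableEq Var]

/-- Number of writes recorded in a local state. -/
def numWrites (l : LocalState Var Val Lab Op Resp) : ℕ :=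
  l.countP fun e => match e with
    | .write _ _ => true
    | _ => false

/-- Whether an invoked operation has not yet returned, according to a local state. -/
def pending (l : LocalState Var Val Lab Op Resp) : Bool :=
  l.foldl (fun p e => match e with
    | .invoke _ => true
    | .ret _ => false
    | _ => p) false

/-- The newest entry for `x` in a buffer. -/
def newest (β : List (Item Var Val)) (x : Var) : Option (Item Var Val) :=
  (β.filter fun it => decide (it.var = x)).getLast?

/-- The event produced by a process performing an action in a global state. -/
def procEvent (g : GState n Var Val Lab Op Resp) (i : Fin n) :
    Act Var Val Lab Resp → Event Var Val Lab Resp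
  | .read x =>
      match newest (g.store.buf i) x with
      | some it => .rfb x it.val it.idx
      | none => .rfm x (g.store.mem x)
  | .write x v => .write x v (numWrites (g.loc i))
  | .fence => .fence
  | .rmw x ve vn => .rmw x ve vn
  | .internal a => .internal a
  | .ret ρ => .ret ρ

/-- The event, if any, that an agent produces when a joint action is performed. -/
def eventOf (g : GState n Var Val Lab Op Resp) (a : JointAction n Var Val Lab Op Resp) :
    Agent n → Option (Event Var Val Lab Resp)
  | .proc i => (a.act i).map (procEvent g i)
  | .disp i =>
      if a.prop i then (g.store.buf i).head?.map fun it => .prop it.var it.val it.idx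
      else none

/-- Preconditions of process actions. A return is the response to a pending operation. -/
def ActEnabled (g : GState n Var Val Lab Op Resp) (i : Fin n) : Act Var Val Lab Resp → Prop
  | .fence => g.store.buf i = []
  | .rmw x ve _ => g.store.buf i = [] ∧ g.store.mem x = ve
  | .ret _ => pending (g.loc i) = true
  | _ => True

/-- Two events of agents `b` and `c` conflict: both are memory accesses to the same variable, at
least one is not a read from memory, and they are not a propagation by `d_i` together with
a read from memory by `i`. -/
def Conflict (b c : Agent n) (e f : Event Var Val Lab Resp) : Prop :=
  (∃ x, e.access = some x ∧ f.access = some x) ∧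
  ¬ (e.IsRfM ∧ f.IsRfM) ∧
  ¬ (∃ i, (b = .disp i ∧ c = .proc i ∧ e.IsProp ∧ f.IsRfM) ∨
          (c = .disp i ∧ b = .proc i ∧ f.IsProp ∧ e.IsRfM))

/-- A joint action that can take place in a global state: all its actions are enabled there and
they do not conflict. The environment invokes an operation at a process only when no operation
is pending there. -/
structure Enabled (g : GState n Var Val Lab Op Resp)
    (a : JointAction n Var Val Lab Op Resp) : Prop where
  act : ∀ i α, a.act i = some α → ActEnabled g i α
  prop : ∀ i, a.prop i = true → g.store.buf i ≠ []
  inv : ∀ i o, a.inv i = some o → pending (g.loc i) = false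
  noConflict : ∀ b c e f, b ≠ c → eventOf g a b = some e → eventOf g a c = some f →
    ¬ Conflict b c e f

/-- The effect of a single event of an agent on the TSO state. -/
def effect (σ : Store n Var Val) (b : Agent n) :
    Event Var Val Lab Resp → Store n Var Val
  | .write x v k =>
      { σ with buf := Function.update σ.buf b.owner (σ.buf b.owner ++ [⟨x, v, k⟩]) }
  | .rmw x _ vn => { σ with mem := Function.update σ.mem x vn }
  | .prop x v _ =>
      { mem := Function.update σ.mem x v
        buf := Function.update σ.buf b.owner (σ.buf b.owner).tail }
  | _ => σ

/-- The order in which the components of a joint action are executed. -/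
def agents (n : ℕ) : List (Agent n) :=
  (List.finRange n).map Agent.proc ++ (List.finRange n).map Agent.disp

/-- The global state resulting from a joint action: the TSO state is obtained by executing the
components one by one, and the local states are extended by the new records. -/
def next (g : GState n Var Val Lab Op Resp) (a : JointAction n Var Val Lab Op Resp) :
    GState n Var Val Lab Op Resp where
  store := (agents n).foldl (fun σ b =>
    match eventOf g a b with
    | some e => effect σ b e
    | none => σ) g.store
  loc := fun i => g.loc i ++
    (match a.act i with
      | some α => (procEvent g i α).record
      | none => []) ++
    (match a.inv i with
      | some o => [.invoke o]
      | none => [])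

end Semantics

/-! ### Protocols and runs -/

/-- A (nondeterministic) protocol for `n` processes together with the initial contents of the
memory. -/
structure Protocol (n : ℕ) (Var Val Lab Op Resp : Type*) where
  step : Fin n → LocalState Var Val Lab Op Resp → Set (Option (Act Var Val Lab Resp))
  step_nonempty : ∀ i l, (step i l).Nonempty
  mem₀ : Var → Val

/-- A sequence of global states, with the joint actions performed in the successive rounds:
`joint t` is performed in `state t`. -/
structure Run (n : ℕ) (Var Val Lab Op Resp : Type*) where
  state : ℕ → GState n Var Val Lab Op Resp
  joint : ℕ → JointAction n Var Val Lab Op Resp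

/-- A node `⟨b, t⟩`: the point at time `t` on the timeline of agent `b`. -/
abbrev Node (n : ℕ) := Agent n × ℕ

section Runs

variable {n : ℕ} {Var Val Lab Op Resp : Type*} [DecidableEq Var]

/-- `r` is a TSO run of the protocol `P`. -/
structure Protocol.IsRun (P : Protocol n Var Val Lab Op Resp)
    (r : Run n Var Val Lab Op Resp) : Prop where
  mem_zero : (r.state 0).store.mem = P.mem₀
  buf_zero : ∀ i, (r.state 0).store.buf i = []
  loc_zero : ∀ i, (r.state 0).loc i = []
  enabled : ∀ t, Enabled (r.state t) (r.joint t)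
  state_succ : ∀ t, r.state (t + 1) = next (r.state t) (r.joint t)
  follows : ∀ t i α, (r.joint t).act i = some α → some α ∈ P.step i ((r.state t).loc i)

/-- The event at a node. -/
def Run.event (r : Run n Var Val Lab Op Resp) (θ : Node n) : Option (Event Var Val Lab Resp) :=
  eventOf (r.state θ.2) (r.joint θ.2) θ.1

/-- The TSO occurs-before relation between nodes of a run. -/
inductive Run.OB (r : Run n Var Val Lab Op Resp) : Node n → Node n → Prop
  | locality (b : Agent n) (t t' : ℕ) : t < t' → Run.OB r (b, t) (b, t')
  | write_prop (i : Fin n) (t t' : ℕ) (x x' : Var) (v v' : Val) (k : ℕ) : t < t' →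
      r.event (.proc i, t) = some (.write x v k) →
      r.event (.disp i, t') = some (.prop x' v' k) →
      Run.OB r (.proc i, t) (.disp i, t')
  | rfb_prop (i : Fin n) (t t' : ℕ) (x x' : Var) (v v' : Val) (k : ℕ) : t < t' →
      r.event (.proc i, t) = some (.rfb x v k) →
      r.event (.disp i, t') = some (.prop x' v' k) →
      Run.OB r (.proc i, t) (.disp i, t')
  | memory (b c : Agent n) (t t' : ℕ) (x : Var) (e f : Event Var Val Lab Resp) : t < t' →
      r.event (b, t) = some e → r.event (c, t') = some f →
      e.access = some x → f.access = some x →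
      ¬ (e.IsRfM ∧ f.IsRfM) →
      ¬ (∃ i, b = .disp i ∧ c = .proc i ∧ e.IsProp ∧ f.IsRfM) →
      Run.OB r (b, t) (c, t')
  | sync (i : Fin n) (t t' : ℕ) (e f : Event Var Val Lab Resp) : t < t' →
      r.event (.disp i, t) = some e → e.IsProp →
      r.event (.proc i, t') = some f → f.IsSync →
      Run.OB r (.disp i, t) (.proc i, t')
  | trans (θ₁ θ₂ θ₃ : Node n) : Run.OB r θ₁ θ₂ → Run.OB r θ₂ θ₃ → Run.OB r θ₁ θ₃

/-- No process reads an item from its buffer in the very round in which its dispatcher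
propagates that same item. -/
def Run.NoReadDuringProp (r : Run n Var Val Lab Op Resp) : Prop :=
  ∀ (i : Fin n) (t : ℕ) (x x' : Var) (v v' : Val) (k : ℕ),
    ¬ (r.event (.proc i, t) = some (.rfb x v k) ∧ r.event (.disp i, t) = some (.prop x' v' k))

end Runs

/-! ### Operations -/

/-- An operation of a run is identified by the process `proc` at which it is invoked and the time
`start` of its invocation, i.e. the invocation is part of the joint action performed at time
`start`; its initial node is `(.proc proc, start)`. -/
structure OpId (n : ℕ) where
  proc : Fin n
  start : ℕ

section Operations

variable {n : ℕ} {Var Val Lab Op Resp : Type*}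

/-- `X` is an invocation of the operation `o` in `r`. -/
def Run.IsOp (r : Run n Var Val Lab Op Resp) (X : OpId n) (o : Op) : Prop :=
  (r.joint X.start).inv X.proc = some o

/-- The operation `X` of `r` ends at time `e` with response `ρ`: the first return by its process
after the invocation takes place in round `e`, i.e. in the joint action performed at `e - 1`. -/
def Run.EndsWith (r : Run n Var Val Lab Op Resp) (X : OpId n) (e : ℕ) (ρ : Resp) : Prop :=
  (∃ o, r.IsOp X o) ∧
  ∃ u, e = u + 1 ∧ X.start < u ∧ (r.joint u).act X.proc = some (.ret ρ) ∧
    ∀ w ρ', X.start < w → w < u → (r.joint w).act X.proc ≠ some (.ret ρ')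

/-- `X` completes in `r`. -/
def Run.Completes (r : Run n Var Val Lab Op Resp) (X : OpId n) : Prop :=
  ∃ e ρ, r.EndsWith X e ρ

/-- Real-time order: the end of `X` is earlier than the start of `Y`. -/
def Run.Precedes (r : Run n Var Val Lab Op Resp) (X Y : OpId n) : Prop :=
  (∃ o, r.IsOp Y o) ∧ ∃ e ρ, r.EndsWith X e ρ ∧ e < Y.start

/-- Operation `X` occurs before operation `Y`: the initial node of `X` occurs before the final
node of `Y`. -/
def Run.OpOB [DecidableEq Var] (r : Run n Var Val Lab Op Resp) (X Y : OpId n) : Prop :=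
  (∃ o, r.IsOp X o) ∧
  ∃ e ρ, r.EndsWith Y e ρ ∧ r.OB (.proc X.proc, X.start) (.proc Y.proc, e)

/-! ### Linearizability -/

/-- An operation in a linearization, with its response. -/
structure LinEntry (n : ℕ) (Op Resp : Type*) where
  id : OpId n
  op : Op
  resp : Resp

/-- The history of `r` up to time `T` is linearizable with respect to a sequential
specification (a set of sequences of operations and responses): after adding responses to some
of the pending operations and removing the other pending operations, the operations can be
arranged in a sequence that belongs to the specification and that respects the order of the
operations of each process and the real-time order. -/
def Run.LinearizableUpTo (r : Run n Var Val Lab Op Resp)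
    (spec : Set (List (Fin n × Op × Resp))) (T : ℕ) : Prop :=
  ∃ L : List (LinEntry n Op Resp),
    (∀ a ∈ L, a.id.start < T ∧ r.IsOp a.id a.op) ∧
    (∀ a ∈ L, ∀ e ρ, r.EndsWith a.id e ρ → e ≤ T → a.resp = ρ) ∧
    (∀ X e ρ, r.EndsWith X e ρ → e ≤ T → ∃ a ∈ L, a.id = X) ∧
    (L.map LinEntry.id).Nodup ∧
    L.Pairwise (fun a b => a.id.proc = b.id.proc → a.id.start < b.id.start) ∧
    L.Pairwise (fun a b => ¬ r.Precedes b.id a.id) ∧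
    L.map (fun a => (a.id.proc, a.op, a.resp)) ∈ spec

end Operations

/-! ### The snapshot object -/

inductive SnapOp (W : Type*) where
  | update (w : W)
  | scan

/-- Responses; `none` in a view is the initial value of a component. -/
inductive SnapResp (n : ℕ) (W : Type*) where
  | ack
  | view (V : Fin n → Option W)

section Snapshot

variable {n : ℕ} {Var Val Lab W : Type*} [DecidableEq Var]

/-- The value written by the last update of process `k` in a sequential history. -/
def lastUpdate (h : List (Fin n × SnapOp W × SnapResp n W)) (k : Fin n) : Option W :=
  (h.filterMap fun e => match e with
    | (i, .update w, _) => if i = k then some w else none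
    | (_, .scan, _) => none).getLast?

/-- The sequential specification of the single-writer snapshot object. -/
def snapshotSpec (n : ℕ) (W : Type*) : Set (List (Fin n × SnapOp W × SnapResp n W)) :=
  {h | ∀ h₁ h₂ i o ρ, h = h₁ ++ (i, o, ρ) :: h₂ →
    match o with
    | .update _ => ρ = .ack
    | .scan => ρ = .view (lastUpdate h₁)}

/-- Standing convention on runs: a value is written at most once by a given process. -/
def Run.DistinctUpdates {Resp : Type*} (r : Run n Var Val Lab (SnapOp W) Resp) : Prop :=
  ∀ (X Y : OpId n) (w : W), X.proc = Y.proc → r.IsOp X (.update w) → r.IsOp Y (.update w) →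
    X.start = Y.start

/-- The protocol is a linearizable snapshot implementation. -/
def Protocol.IsLinearizableSnapshot
    (P : Protocol n Var Val Lab (SnapOp W) (SnapResp n W)) : Prop :=
  ∀ r, P.IsRun r → r.DistinctUpdates → ∀ T, r.LinearizableUpTo (snapshotSpec n W) T

end Snapshot

end TSO
/-! If the start of `X` does not occur before the end of `Y`, then the past of the end of `Y` under
occurs-before contains no node of `X`. Performing this past first and postponing everything else
yields another run of the same protocol: what a memory access does depends only on the accesses
it conflicts with, and these are ordered by occurs-before. The one thing that can change is that a
value is read from the buffer instead of from memory, which a process does not record.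
In the new run `Y` returns before `X` is invoked, although every process invokes the same
operations and receives the same responses as before. But updated values are distinct, so the view
that a scan returns determines the updates it follows, and this contradicts linearizability of one
of the two runs. -/


namespace TSO

section Buffers

variable {Var Val : Type*} {l : List (Item Var Val)} {x : Var} {it : Item Var Val}

/-- The `k`-th entry of the list carries the tag `k`, as in the list of all entries ever appended
to a store buffer. -/
def IsTagged (l : List (Item Var Val)) : Prop :=
  ∀ (k : ℕ) (it : Item Var Val), l[k]? = some it → it.idx = k

theorem IsTagged.idx_lt_of_mem_take (hl : IsTagged l) {c : ℕ} (h : it ∈ l.take c) :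
    it.idx < c := by
  obtain ⟨k, hk, rfl⟩ := List.mem_take_iff_getElem.1 h
  rw [hl k _ (List.getElem?_eq_getElem _)]
  omega

theorem IsTagged.le_idx_of_mem_drop (hl : IsTagged l) {c : ℕ} (h : it ∈ l.drop c) :
    c ≤ it.idx := by
  obtain ⟨k, hk, rfl⟩ := List.mem_drop_iff_getElem.1 h
  rw [hl (c + k) _ (List.getElem?_eq_getElem _)]
  exact Nat.le_add_right c k

variable [DecidableEq Var]

theorem newest_append (l l' : List (Item Var Val)) (x : Var) :
    newest (l ++ l') x = (newest l' x).or (newest l x) := by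
  simp [newest, List.filter_append, List.getLast?_append]

theorem newest_eq_none_iff : newest l x = none ↔ ∀ it ∈ l, it.var ≠ x := by
  simp [newest]

theorem mem_of_newest_eq_some (h : newest l x = some it) : it ∈ l ∧ it.var = x := by
  simpa using List.mem_of_getLast? h

theorem IsTagged.newest_drop (hl : IsTagged l) (c : ℕ) (x : Var) :
    newest (l.drop c) x = (newest l x).filter fun it => c ≤ it.idx := by
  conv_rhs => rw [← List.take_append_drop c l, newest_append]
  cases hd : newest (l.drop c) x with
  | some it => simp [Option.filter_some, hl.le_idx_of_mem_drop (mem_of_newest_eq_some hd).1]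
  | none =>
    cases ht : newest (l.take c) x with
    | some it => simp [Option.filter_some, hl.idx_lt_of_mem_take (mem_of_newest_eq_some ht).1]
    | none => rfl

theorem IsTagged.exists_newest (hl : IsTagged l) {k : ℕ} (h : l[k]? = some it) :
    ∃ it', newest l it.var = some it' ∧ k ≤ it'.idx := by
  have hne : newest (l.drop k) it.var ≠ none := fun hnone =>
    newest_eq_none_iff.1 hnone it (List.mem_of_getElem? (i := 0) (by simpa using h)) rfl
  rw [hl.newest_drop] at hne
  simpa [Option.ne_none_iff_exists', Option.filter_eq_some_iff] using hne

end Buffers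

section Rounds

variable {n : ℕ} {Var Val Lab Op Resp : Type*} {b c : Agent n} {e f : Event Var Val Lab Resp}
  {x : Var} {v w : Val}

/-- The variable in main memory that an event overwrites, if any, and its new value. -/
def Event.memWrite : Event Var Val Lab Resp → Option (Var × Val)
  | .rmw x _ vn => some (x, vn)
  | .prop x v _ => some (x, v)
  | _ => none

/-- The entry, if any, that an event appends to a store buffer. -/
def Event.written : Event Var Val Lab Resp → List (Item Var Val)
  | .write x v k => [⟨x, v, k⟩]
  | _ => []

theorem Event.access_of_memWrite (h : e.memWrite = some (x, v)) : e.access = some x := by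
  cases e <;> simp_all [Event.memWrite, Event.access]

theorem Event.not_isRfM_of_memWrite (h : e.memWrite = some (x, v)) : ¬ e.IsRfM := by
  cases e <;> simp_all [Event.memWrite, Event.IsRfM]

theorem Conflict.symm (h : Conflict b c e f) : Conflict c b f e :=
  ⟨h.1.imp fun _ => And.symm, fun hr => h.2.1 hr.symm, fun ⟨i, hi⟩ => h.2.2 ⟨i, hi.symm⟩⟩

theorem Conflict.of_memWrite (he : e.memWrite = some (x, v)) (hf : f.memWrite = some (x, w)) :
    Conflict b c e f := by
  refine ⟨⟨x, Event.access_of_memWrite he, Event.access_of_memWrite hf⟩,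
    fun h => Event.not_isRfM_of_memWrite he h.1, ?_⟩
  rintro ⟨i, ⟨-, -, -, h⟩ | ⟨-, -, -, h⟩⟩
  exacts [Event.not_isRfM_of_memWrite hf h, Event.not_isRfM_of_memWrite he h]

theorem Conflict.of_memWrite_of_rfm {i : Fin n} (he : e.memWrite = some (x, v))
    (hb : b ≠ .disp i) : Conflict b (.proc i) e (.rfm x w) := by
  refine ⟨⟨x, Event.access_of_memWrite he, rfl⟩,
    fun h => Event.not_isRfM_of_memWrite he h.1, ?_⟩
  rintro ⟨j, ⟨rfl, hj, -⟩ | ⟨hj, -⟩⟩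
  · exact hb (congrArg Agent.disp (Agent.proc.inj hj).symm)
  · cases hj

variable [DecidableEq Var] {g : GState n Var Val Lab Op Resp}
  {a : JointAction n Var Val Lab Op Resp} {i : Fin n}

theorem eventOf_disp_eq_some (h : eventOf g a (.disp i) = some e) :
    ∃ it, (g.store.buf i).head? = some it ∧ e = .prop it.var it.val it.idx := by
  rw [eventOf] at h
  split_ifs at h
  obtain ⟨it, hit, rfl⟩ := Option.map_eq_some_iff.1 h
  exact ⟨it, hit, rfl⟩

theorem not_isProp_of_eventOf_proc (h : eventOf g a (.proc i) = some e) : ¬ e.IsProp := by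
  obtain ⟨α, -, rfl⟩ := Option.map_eq_some_iff.1 h
  cases α with
  | read x => cases hn : newest (g.store.buf i) x <;> simp [procEvent, hn, Event.IsProp]
  | _ => simp [procEvent, Event.IsProp]

theorem eventOf_disp_isSome_iff :
    (eventOf g a (.disp i)).isSome ↔ a.prop i = true ∧ g.store.buf i ≠ [] := by
  cases hp : a.prop i <;> simp [eventOf, hp]

theorem idx_eq_of_mem_written {it : Item Var Val} (h : eventOf g a (.proc i) = some e)
    (hit : it ∈ e.written) : it.idx = numWrites (g.loc i) := by
  obtain ⟨α, -, rfl⟩ := Option.map_eq_some_iff.1 h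
  cases α with
  | read x => cases hn : newest (g.store.buf i) x <;> simp [procEvent, hn, Event.written] at hit
  | write x v => simp_all [procEvent, Event.written]
  | _ => simp [procEvent, Event.written] at hit

theorem next_loc (g : GState n Var Val Lab Op Resp) (a : JointAction n Var Val Lab Op Resp)
    (i : Fin n) : (next g a).loc i =
      g.loc i ++ (eventOf g a (.proc i)).elim [] Event.record ++
        (a.inv i).elim [] fun o => [.invoke o] := by
  cases hα : a.act i <;> cases ho : a.inv i <;> simp [next, eventOf, hα, ho]

theorem numWrites_next (g : GState n Var Val Lab Op Resp)
    (a : JointAction n Var Val Lab Op Resp) (i : Fin n) : numWrites ((next g a).loc i) =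
      numWrites (g.loc i) + ((eventOf g a (.proc i)).elim [] Event.written).length := by
  rw [next_loc]
  simp only [numWrites, List.countP_append, add_assoc, add_right_inj]
  cases eventOf g a (.proc i) with
  | none => cases a.inv i <;> rfl
  | some e => cases e <;> cases a.inv i <;> rfl

/-- The effect of the component of a joint action that belongs to agent `b`. -/
def agentEffect (g : GState n Var Val Lab Op Resp) (a : JointAction n Var Val Lab Op Resp)
    (σ : Store n Var Val) (b : Agent n) : Store n Var Val :=
  match eventOf g a b with
  | some e => effect σ b e
  | none => σ

theorem next_store (g : GState n Var Val Lab Op Resp) (a : JointAction n Var Val Lab Op Resp) :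
    (next g a).store = (agents n).foldl (agentEffect g a) g.store := rfl

theorem mem_agents (b : Agent n) : b ∈ agents n := by
  cases b <;> simp [agents]

theorem effect_mem_of_memWrite (σ : Store n Var Val) (b : Agent n)
    (h : e.memWrite = some (x, v)) : (effect σ b e).mem x = v := by
  cases e <;> simp_all [effect, Event.memWrite]

theorem effect_mem_of_memWrite_ne (σ : Store n Var Val) (b : Agent n)
    (h : ∀ v, e.memWrite ≠ some (x, v)) : (effect σ b e).mem x = σ.mem x := by
  cases e <;> simp_all [effect, Event.memWrite, eq_comm]

theorem agentEffect_mem_of_memWrite_ne (σ : Store n Var Val)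
    (h : ∀ e v, eventOf g a b = some e → e.memWrite ≠ some (x, v)) :
    (agentEffect g a σ b).mem x = σ.mem x := by
  rw [agentEffect]
  cases hb : eventOf g a b with
  | none => rfl
  | some e => exact effect_mem_of_memWrite_ne σ b fun v => h e v hb

theorem next_mem_of_forall_ne
    (h : ∀ b e v, eventOf g a b = some e → e.memWrite ≠ some (x, v)) :
    (next g a).store.mem x = g.store.mem x := by
  rw [next_store]
  exact List.foldlRecOn (motive := fun σ => σ.mem x = g.store.mem x) _ _ rfl
    fun σ hσ b _ => (agentEffect_mem_of_memWrite_ne σ (h b)).trans hσ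

theorem Enabled.eq_of_memWrite (ha : Enabled g a) (hb : eventOf g a b = some e)
    (hc : eventOf g a c = some f) (he : e.memWrite = some (x, v))
    (hf : f.memWrite = some (x, w)) : b = c := by
  by_contra hbc
  exact ha.noConflict b c e f hbc hb hc (.of_memWrite he hf)

theorem Enabled.next_mem_of_memWrite (ha : Enabled g a) (hb : eventOf g a b = some e)
    (he : e.memWrite = some (x, v)) : (next g a).store.mem x = v := by
  obtain ⟨l, l', hl⟩ := List.append_of_mem (mem_agents b)
  rw [next_store, hl, List.foldl_append, List.foldl_cons]
  refine List.foldlRecOn (motive := fun σ : Store n Var Val => σ.mem x = v) _ _ ?_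
    fun σ hσ c _ => ?_
  · simpa [agentEffect, hb] using effect_mem_of_memWrite _ b he
  · by_cases hbc : b = c
    · subst hbc
      simpa [agentEffect, hb] using effect_mem_of_memWrite σ b he
    · rw [agentEffect_mem_of_memWrite_ne σ fun f w hc hf => hbc (ha.eq_of_memWrite hb hc he hf),
        hσ]

theorem filter_agents_owner (i : Fin n) :
    (agents n).filter (fun b => decide (b.owner = i)) = [.proc i, .disp i] := by
  have h : (List.finRange n).filter (fun j => decide (j = i)) = [i] := by
    rw [List.filter_eq, List.count_eq_one_of_mem (List.nodup_finRange n) (List.mem_finRange i)]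
    rfl
  have hproc : (fun b : Agent n => decide (b.owner = i)) ∘ .proc = fun j => decide (j = i) := rfl
  have hdisp : (fun b : Agent n => decide (b.owner = i)) ∘ .disp = fun j => decide (j = i) := rfl
  rw [agents, List.filter_append, List.filter_map, List.filter_map, hproc, hdisp, h]
  rfl

theorem foldl_agentEffect_buf (i : Fin n) (l : List (Agent n)) {σ τ : Store n Var Val}
    (h : σ.buf i = τ.buf i) :
    (l.foldl (agentEffect g a) σ).buf i =
      ((l.filter fun b => decide (b.owner = i)).foldl (agentEffect g a) τ).buf i := by
  induction l generalizing σ τ with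
  | nil => simpa using h
  | cons b l ih =>
    rw [List.foldl_cons, List.filter_cons]
    by_cases hb : b.owner = i
    · simp only [hb, decide_true, if_true, List.foldl_cons]
      apply ih
      rw [agentEffect, agentEffect]
      cases eventOf g a b with
      | none => exact h
      | some e => cases e <;> simp [effect, hb, h]
    · simp only [hb, decide_false]
      apply ih
      rw [← h, agentEffect]
      cases eventOf g a b with
      | none => rfl
      | some e => cases e <;> simp [effect, Function.update_of_ne (Ne.symm hb)]

theorem next_buf (g : GState n Var Val Lab Op Resp) (a : JointAction n Var Val Lab Op Resp)
    (i : Fin n) : (next g a).store.buf i =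
      (g.store.buf i ++ (eventOf g a (.proc i)).elim [] Event.written).drop
        (if (eventOf g a (.disp i)).isSome then 1 else 0) := by
  have hproc : (agentEffect g a g.store (.proc i)).buf i =
      g.store.buf i ++ (eventOf g a (.proc i)).elim [] Event.written := by
    rw [agentEffect]
    cases he : eventOf g a (.proc i) with
    | none => simp
    | some e =>
      have := not_isProp_of_eventOf_proc he
      cases e <;> simp_all [effect, Event.written, Agent.owner, Event.IsProp]
  rw [next_store, foldl_agentEffect_buf i _ rfl, filter_agents_owner, ← hproc]
  simp only [List.foldl_cons, List.foldl_nil]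
  generalize agentEffect g a g.store (.proc i) = σ
  rw [agentEffect]
  cases hd : eventOf g a (.disp i) with
  | none => simp
  | some e =>
    obtain ⟨it, -, rfl⟩ := eventOf_disp_eq_some hd
    simp [effect, Agent.owner]

theorem next_buf_eq_drop {k : ℕ} {l : List (Item Var Val)}
    (hl : g.store.buf i = l.drop k) (hk : k ≤ l.length) :
    (next g a).store.buf i = (l ++ (eventOf g a (.proc i)).elim [] Event.written).drop
      (k + if (eventOf g a (.disp i)).isSome then 1 else 0) := by
  rw [next_buf, hl, ← List.drop_append_of_le_length hk, List.drop_drop]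

end Rounds

section Runs

variable {n : ℕ} {Var Val Lab Op Resp : Type*} [DecidableEq Var]

/-- The number of propagations by the dispatcher of `i` before time `t`. -/
def Run.propCount (r : Run n Var Val Lab Op Resp) (i : Fin n) (t : ℕ) : ℕ :=
  Nat.count (fun u => (r.event (.disp i, u)).isSome) t

/-- All entries appended to the buffer of `i` before time `t`, propagated or not. -/
def Run.items (r : Run n Var Val Lab Op Resp) (i : Fin n) : ℕ → List (Item Var Val)
  | 0 => []
  | t + 1 => r.items i t ++ (r.event (.proc i, t)).elim [] Event.written

theorem Run.propCount_succ (r : Run n Var Val Lab Op Resp) (i : Fin n) (t : ℕ) :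
    r.propCount i (t + 1) = r.propCount i t + if (r.event (.disp i, t)).isSome then 1 else 0 :=
  Nat.count_succ _ t

theorem Run.propCount_mono (r : Run n Var Val Lab Op Resp) (i : Fin n) :
    Monotone (r.propCount i) :=
  Nat.count_monotone _

theorem Run.items_prefix_of_le (r : Run n Var Val Lab Op Resp) (i : Fin n) {s t : ℕ} (h : s ≤ t) :
    r.items i s <+: r.items i t := by
  induction t, h using Nat.le_induction with
  | base => exact List.prefix_rfl
  | succ t _ ih => exact ih.trans (List.prefix_append _ _)

theorem Run.items_getElem? (r : Run n Var Val Lab Op Resp) {i : Fin n} {s t k : ℕ} (h : s ≤ t)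
    (hk : k < (r.items i s).length) : (r.items i t)[k]? = (r.items i s)[k]? := by
  obtain ⟨l, hl⟩ := r.items_prefix_of_le i h
  rw [← hl, List.getElem?_append_left hk]

theorem Run.exists_prop (r : Run n Var Val Lab Op Resp) {i : Fin n} {s t k : ℕ}
    (hs : r.propCount i s ≤ k) (ht : k < r.propCount i t) :
    ∃ u, s ≤ u ∧ u < t ∧ r.propCount i u = k ∧ ∃ e, r.event (.disp i, u) = some e := by
  have hst : s ≤ t := ((r.propCount_mono i).reflect_lt (hs.trans_lt ht)).le
  induction t, hst using Nat.le_induction with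
  | base => omega
  | succ t hst ih =>
    by_cases hk : k < r.propCount i t
    · obtain ⟨u, hsu, hut, hu⟩ := ih hk
      exact ⟨u, hsu, by omega, hu⟩
    · rw [r.propCount_succ] at ht
      split_ifs at ht with he
      · exact ⟨t, hst, by omega, by omega, Option.isSome_iff_exists.1 he⟩
      · omega

namespace Run.OB

variable {r : Run n Var Val Lab Op Resp}

theorem lt {θ θ' : Node n} (h : r.OB θ θ') : θ.2 < θ'.2 := by
  induction h with
  | trans _ _ _ _ _ h h' => exact h.trans h'
  | _ => assumption

theorem of_conflict {b c : Agent n} {t t' : ℕ} {e f : Event Var Val Lab Resp} (h : t < t')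
    (hb : r.event (b, t) = some e) (hc : r.event (c, t') = some f) (hef : Conflict b c e f) :
    r.OB (b, t) (c, t') := by
  obtain ⟨⟨x, he, hf⟩, hread, hprop⟩ := hef
  exact .memory b c t t' x e f h hb hc he hf hread fun ⟨i, hi⟩ => hprop ⟨i, .inl hi⟩

end Run.OB

namespace Protocol.IsRun

variable {P : Protocol n Var Val Lab Op Resp} {r : Run n Var Val Lab Op Resp} {i : Fin n}
  {t : ℕ} {x : Var} {v : Val} {e : Event Var Val Lab Resp}

theorem length_items (hr : P.IsRun r) (i : Fin n) (t : ℕ) :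
    (r.items i t).length = numWrites ((r.state t).loc i) := by
  induction t with
  | zero => rw [hr.loc_zero]; rfl
  | succ t ih => rw [hr.state_succ, numWrites_next, ← ih]; exact List.length_append

theorem isTagged_items (hr : P.IsRun r) (i : Fin n) (t : ℕ) : IsTagged (r.items i t) := by
  induction t with
  | zero => simp [IsTagged, Run.items]
  | succ t ih =>
    intro k it hit
    rcases lt_or_ge k (r.items i t).length with hk | hk
    · exact ih k it (r.items_getElem? t.le_succ hk ▸ hit)
    · rw [Run.items, List.getElem?_append_right hk] at hit
      cases he : r.event (.proc i, t) with
      | none => simp [he] at hit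
      | some e =>
        rw [he] at hit
        have hidx : it.idx = numWrites ((r.state t).loc i) :=
          idx_eq_of_mem_written he (List.mem_of_getElem? hit)
        rw [← hr.length_items] at hidx
        have hlen : e.written.length ≤ 1 := by cases e <;> simp [Event.written]
        have := (List.getElem?_eq_some_iff.1 hit).1
        simp only [Option.elim_some] at this
        omega

theorem exists_write (hr : P.IsRun r) {k : ℕ} {it : Item Var Val}
    (h : (r.items i t)[k]? = some it) :
    ∃ u < t, r.event (.proc i, u) = some (.write it.var it.val k) ∧
      k < (r.items i (u + 1)).length := by
  induction t with
  | zero => simp [Run.items] at h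
  | succ t ih =>
    rcases lt_or_ge k (r.items i t).length with hk | hk
    · obtain ⟨u, hut, hu⟩ := ih (r.items_getElem? t.le_succ hk ▸ h)
      exact ⟨u, by omega, hu⟩
    · have hidx := hr.isTagged_items i _ k it h
      refine ⟨t, t.lt_succ_self, ?_, (List.getElem?_eq_some_iff.1 h).1⟩
      rw [Run.items, List.getElem?_append_right hk] at h
      have hmem := List.mem_of_getElem? h
      cases he : r.event (.proc i, t) with
      | none => simp [he] at hmem
      | some e => cases e <;> simp_all [Event.written]

theorem buf_eq_and_propCount_le (hr : P.IsRun r) (i : Fin n) (t : ℕ) :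
    (r.state t).store.buf i = (r.items i t).drop (r.propCount i t) ∧
      r.propCount i t ≤ (r.items i t).length := by
  induction t with
  | zero => simp [hr.buf_zero, Run.items, Run.propCount]
  | succ t ih =>
    obtain ⟨hbuf, hle⟩ := ih
    have hlen := (r.items_prefix_of_le i t.le_succ).length_le
    refine ⟨?_, ?_⟩
    · rw [hr.state_succ, next_buf_eq_drop hbuf hle, r.propCount_succ]
      rfl
    · rw [r.propCount_succ]
      split_ifs with he
      · have hne := (eventOf_disp_isSome_iff.1 he).2
        rw [hbuf, ne_eq, List.drop_eq_nil_iff] at hne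
        rw [Nat.succ_eq_add_one] at hlen
        omega
      · exact hle.trans hlen

theorem buf_eq (hr : P.IsRun r) (i : Fin n) (t : ℕ) :
    (r.state t).store.buf i = (r.items i t).drop (r.propCount i t) :=
  (hr.buf_eq_and_propCount_le i t).1

theorem event_disp (hr : P.IsRun r) (h : r.event (.disp i, t) = some e) :
    ∃ it, (r.items i t)[r.propCount i t]? = some it ∧
      e = .prop it.var it.val (r.propCount i t) := by
  obtain ⟨it, hit, rfl⟩ := eventOf_disp_eq_some h
  simp only [hr.buf_eq, List.head?_drop] at hit
  exact ⟨it, hit, by rw [hr.isTagged_items i t _ _ hit]⟩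

theorem exists_newest_of_event_disp (hr : P.IsRun r) {u : ℕ} (hut : u ≤ t)
    (h : r.event (.disp i, u) = some e) (he : e.memWrite = some (x, v)) :
    ∃ it, newest (r.items i t) x = some it ∧ r.propCount i u ≤ it.idx := by
  obtain ⟨it, hit, rfl⟩ := hr.event_disp h
  cases he
  rw [← r.items_getElem? hut (List.getElem?_eq_some_iff.1 hit).1] at hit
  exact (hr.isTagged_items i t).exists_newest hit

theorem mem_eq_of_forall_ne (hr : P.IsRun r) {s : ℕ} (hst : s ≤ t)
    (h : ∀ b u e v, s ≤ u → u < t → r.event (b, u) = some e → e.memWrite ≠ some (x, v)) :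
    (r.state t).store.mem x = (r.state s).store.mem x := by
  induction t, hst using Nat.le_induction with
  | base => rfl
  | succ t hst ih =>
    have hnext := next_mem_of_forall_ne (g := r.state t) (a := r.joint t) fun b e v =>
      h b t e v hst t.lt_succ_self
    rw [hr.state_succ, hnext]
    exact ih fun b u e v hsu hut => h b u e v hsu (hut.trans t.lt_succ_self)

theorem mem_succ (hr : P.IsRun r) {b : Agent n} (hb : r.event (b, t) = some e)
    (he : e.memWrite = some (x, v)) : (r.state (t + 1)).store.mem x = v := by
  rw [hr.state_succ]
  exact (hr.enabled t).next_mem_of_memWrite hb he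

end Protocol.IsRun

end Runs

section Imitation

variable {n : ℕ} {Var Val Lab Op Resp : Type*} {e e' f f' : Event Var Val Lab Resp}

/-- `Event.Matches e' e` says that `e'` leaves the same record as `e`: it equals `e`, or it reads
from the buffer the value that `e` reads from memory. -/
inductive Event.Matches : Event Var Val Lab Resp → Event Var Val Lab Resp → Prop
  | refl (e : Event Var Val Lab Resp) : Matches e e
  | rfb_rfm (x : Var) (v : Val) (k : ℕ) : Matches (.rfb x v k) (.rfm x v)

namespace Event.Matches

theorem record_eq (h : e'.Matches e) :
    (e'.record : List (Record Var Val Lab Op Resp)) = e.record := by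
  cases h <;> rfl

theorem written_eq (h : e'.Matches e) : e'.written = e.written := by
  cases h <;> rfl

theorem memWrite_eq (h : e'.Matches e) : e'.memWrite = e.memWrite := by
  cases h <;> rfl

theorem eq_of_access {x : Var} (h : e'.Matches e) (hx : e'.access = some x) : e' = e := by
  cases h with
  | refl => rfl
  | rfb_rfm => cases hx

end Event.Matches

open Classical in
/-- The part of a joint action that consists of the actions of the agents in `A` and the
invocations at the processes in `A`. -/
noncomputable def JointAction.restrict (a : JointAction n Var Val Lab Op Resp)
    (A : Set (Agent n)) : JointAction n Var Val Lab Op Resp where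
  act i := if .proc i ∈ A then a.act i else none
  prop i := if .disp i ∈ A then a.prop i else false
  inv i := if .proc i ∈ A then a.inv i else none

variable {A : Set (Agent n)} {a : JointAction n Var Val Lab Op Resp} {i : Fin n}

theorem JointAction.restrict_act_eq_some_iff {α : Act Var Val Lab Resp} :
    (a.restrict A).act i = some α ↔ .proc i ∈ A ∧ a.act i = some α := by
  simp [restrict]

theorem JointAction.restrict_prop_iff :
    (a.restrict A).prop i = true ↔ .disp i ∈ A ∧ a.prop i = true := by
  simp [restrict]

theorem JointAction.restrict_inv_eq_some_iff {o : Op} :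
    (a.restrict A).inv i = some o ↔ .proc i ∈ A ∧ a.inv i = some o := by
  simp [restrict]

variable [DecidableEq Var] {g g' : GState n Var Val Lab Op Resp} {b : Agent n}

theorem eventOf_restrict_of_mem (hb : b ∈ A) : eventOf g (a.restrict A) b = eventOf g a b := by
  cases b <;> simp [eventOf, JointAction.restrict, hb]

theorem eventOf_restrict_of_notMem (hb : b ∉ A) : eventOf g (a.restrict A) b = none := by
  cases b <;> simp [eventOf, JointAction.restrict, hb]

theorem next_restrict_loc_of_notMem (hi : .proc i ∉ A) :
    (next g (a.restrict A)).loc i = g.loc i := by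
  have hinv : (a.restrict A).inv i = none := by simp [JointAction.restrict, hi]
  simp [next_loc, eventOf_restrict_of_notMem hi, hinv]

/-- In the state `g'` the agents in `A` can perform their parts of the joint action `a`, and they
cannot tell the outcome from that in `g`. -/
structure Imitates (A : Set (Agent n)) (a : JointAction n Var Val Lab Op Resp)
    (g g' : GState n Var Val Lab Op Resp) : Prop where
  loc : ∀ i, .proc i ∈ A → g'.loc i = g.loc i
  act : ∀ i α, .proc i ∈ A → a.act i = some α → ActEnabled g' i α
  event : ∀ b ∈ A, Option.Rel Event.Matches (eventOf g' a b) (eventOf g a b)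

namespace Imitates

theorem exists_event (h : Imitates A a g g') (he : eventOf g' (a.restrict A) b = some e') :
    b ∈ A ∧ ∃ e, eventOf g a b = some e ∧ e'.Matches e := by
  by_cases hb : b ∈ A
  · rw [eventOf_restrict_of_mem hb] at he
    have hrel := h.event b hb
    rw [he] at hrel
    cases hg : eventOf g a b with
    | none => rw [hg] at hrel; cases hrel
    | some e => rw [hg] at hrel; cases hrel with | some hm => exact ⟨hb, e, rfl, hm⟩
  · rw [eventOf_restrict_of_notMem hb] at he
    cases he

theorem exists_event_restrict (h : Imitates A a g g') (hb : b ∈ A)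
    (he : eventOf g a b = some e) :
    ∃ e', eventOf g' (a.restrict A) b = some e' ∧ e'.Matches e := by
  have hrel := h.event b hb
  rw [he] at hrel
  rw [eventOf_restrict_of_mem hb]
  cases hg : eventOf g' a b with
  | none => rw [hg] at hrel; cases hrel
  | some e' => rw [hg] at hrel; cases hrel with | some hm => exact ⟨e', rfl, hm⟩

theorem enabled_restrict (h : Imitates A a g g') (ha : Enabled g a) :
    Enabled g' (a.restrict A) where
  act i α hα := by
    obtain ⟨hi, hα⟩ := JointAction.restrict_act_eq_some_iff.1 hα
    exact h.act i α hi hα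
  prop i hp := by
    obtain ⟨hi, hp⟩ := JointAction.restrict_prop_iff.1 hp
    obtain ⟨e, he⟩ := Option.isSome_iff_exists.1 (eventOf_disp_isSome_iff.2 ⟨hp, ha.prop i hp⟩)
    obtain ⟨e', he', -⟩ := h.exists_event_restrict hi he
    exact (eventOf_disp_isSome_iff.1 (Option.isSome_iff_exists.2 ⟨e', he'⟩)).2
  inv i o ho := by
    obtain ⟨hi, ho⟩ := JointAction.restrict_inv_eq_some_iff.1 ho
    rw [h.loc i hi]
    exact ha.inv i o ho
  noConflict b c e' f' hbc hb hc hconf := by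
    obtain ⟨-, e, he, hme⟩ := h.exists_event hb
    obtain ⟨-, f, hf, hmf⟩ := h.exists_event hc
    obtain ⟨x, hx, hy⟩ := hconf.1
    rw [hme.eq_of_access hx, hmf.eq_of_access hy] at hconf
    exact ha.noConflict b c e f hbc he hf hconf

theorem elim_eq {β : Type*} (h : Imitates A a g g') (hb : b ∈ A) (z : β)
    {φ : Event Var Val Lab Resp → β} (hφ : ∀ e' e, Event.Matches e' e → φ e' = φ e) :
    (eventOf g' (a.restrict A) b).elim z φ = (eventOf g a b).elim z φ := by
  have hrel := h.event b hb
  rw [eventOf_restrict_of_mem hb]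
  generalize eventOf g' a b = o', eventOf g a b = o at hrel
  cases hrel with
  | none => rfl
  | some hm => exact hφ _ _ hm

theorem isSome_eq (h : Imitates A a g g') (hb : b ∈ A) :
    (eventOf g' (a.restrict A) b).isSome = (eventOf g a b).isSome := by
  have hrel := h.event b hb
  rw [eventOf_restrict_of_mem hb]
  generalize eventOf g' a b = o', eventOf g a b = o at hrel
  cases hrel <;> rfl

theorem next_loc (h : Imitates A a g g') (hi : .proc i ∈ A) :
    (next g' (a.restrict A)).loc i = (next g a).loc i := by
  have hinv : (a.restrict A).inv i = a.inv i := by simp [JointAction.restrict, hi]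
  rw [TSO.next_loc, TSO.next_loc, h.loc i hi, hinv,
    h.elim_eq hi [] fun _ _ => Event.Matches.record_eq]

theorem next_mem (h : Imitates A a g g') (ha : Enabled g a) {x : Var}
    (hmem : g'.store.mem x = g.store.mem x)
    (hA : ∀ b e v, eventOf g a b = some e → e.memWrite = some (x, v) → b ∈ A) :
    (next g' (a.restrict A)).store.mem x = (next g a).store.mem x := by
  by_cases hw : ∃ b e v, eventOf g a b = some e ∧ e.memWrite = some (x, v)
  · obtain ⟨b, e, v, he, hx⟩ := hw
    obtain ⟨e', he', hm⟩ := h.exists_event_restrict (hA b e v he hx) he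
    rw [ha.next_mem_of_memWrite he hx,
      (h.enabled_restrict ha).next_mem_of_memWrite he' (hm.memWrite_eq.trans hx)]
  · rw [next_mem_of_forall_ne (g := g) fun b e v he hx => hw ⟨b, e, v, he, hx⟩,
      next_mem_of_forall_ne fun b e' v he' hx => ?_, hmem]
    obtain ⟨-, e, he, hm⟩ := h.exists_event he'
    exact hw ⟨b, e, v, he, hm.memWrite_eq ▸ hx⟩

theorem next_mem_of_notMem (h : Imitates A a g g') {x : Var}
    (hA : ∀ b e v, eventOf g a b = some e → e.memWrite = some (x, v) → b ∉ A) :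
    (next g' (a.restrict A)).store.mem x = g'.store.mem x := by
  refine next_mem_of_forall_ne fun b e' v he' hx => ?_
  obtain ⟨hb, e, he, hm⟩ := h.exists_event he'
  exact hA b e v he (hm.memWrite_eq ▸ hx) hb

end Imitates

end Imitation

section Cuts

/-- A cut: the nodes `⟨b, t⟩` with `t < agent b` lie inside the cut. The memory cell `x` has the
value that it has in the run at time `mem x`. -/
@[ext]
structure Cut (n : ℕ) (Var : Type*) where
  agent : Agent n → ℕ
  mem : Var → ℕ

/-- The agents that perform their next round between the cuts `C` and `C'`. -/
def Cut.moved {n : ℕ} {Var : Type*} (C C' : Cut n Var) : Set (Agent n) :=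
  {b | C.agent b < C'.agent b}

/-- The cut `C'` arises from `C` by performing some part of round `t`. -/
structure Cut.Step {n : ℕ} {Var : Type*} (t : ℕ) (C C' : Cut n Var) : Prop where
  agent : ∀ b, C'.agent b = C.agent b ∨ C.agent b = t ∧ C'.agent b = t + 1
  mem : ∀ x, C'.mem x = C.mem x ∨ C.mem x = t ∧ C'.mem x = t + 1

variable {n : ℕ} {Var Val Lab Op Resp : Type*} [DecidableEq Var]

/-- The cut `C` is closed under occurs-before, and the stores that have reached the memory cell
`x` at time `C.mem x` are those inside the cut. -/
structure Run.IsConsistent (r : Run n Var Val Lab Op Resp) (C : Cut n Var) : Prop where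
  past_closed : ∀ b t b' t', r.OB (b, t) (b', t') → t' < C.agent b' → t < C.agent b
  store_iff : ∀ b t e x v, r.event (b, t) = some e → e.memWrite = some (x, v) →
    (t < C.mem x ↔ t < C.agent b)

/-- The node `θ` is not in the cut `C`, but all nodes that occur before it are. -/
structure Run.IsNext (r : Run n Var Val Lab Op Resp) (C : Cut n Var) (θ : Node n) : Prop where
  agent_eq : C.agent θ.1 = θ.2
  lt_agent : ∀ b t, r.OB (b, t) θ → t < C.agent b

/-- The global state reached by performing exactly the nodes inside the cut `C`. -/
def Run.stateAt (r : Run n Var Val Lab Op Resp) (C : Cut n Var) :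
    GState n Var Val Lab Op Resp where
  store :=
    { mem := fun x => (r.state (C.mem x)).store.mem x
      buf := fun i => (r.items i (C.agent (.proc i))).drop (r.propCount i (C.agent (.disp i))) }
  loc := fun i => (r.state (C.agent (.proc i))).loc i

variable {P : Protocol n Var Val Lab Op Resp} {r : Run n Var Val Lab Op Resp} {C C' : Cut n Var}
  {b : Agent n} {i : Fin n} {t : ℕ} {e : Event Var Val Lab Resp} {x : Var} {v : Val}

omit [DecidableEq Var] in
theorem Cut.Step.of_mem_moved (h : Cut.Step t C C') (hb : b ∈ C.moved C') :
    C.agent b = t ∧ C'.agent b = t + 1 :=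
  (h.agent b).resolve_left (hb : C.agent b < C'.agent b).ne'

omit [DecidableEq Var] in
theorem Cut.Step.of_notMem_moved (h : Cut.Step t C C') (hb : b ∉ C.moved C') :
    C'.agent b = C.agent b :=
  (h.agent b).resolve_right fun ⟨heq, heq'⟩ =>
    hb ((heq.trans_lt t.lt_succ_self).trans_eq heq'.symm)

theorem Run.IsConsistent.isNext (hC' : r.IsConsistent C') (h : Cut.Step t C C')
    (hb : b ∈ C.moved C') : r.IsNext C (b, t) where
  agent_eq := (h.of_mem_moved hb).1
  lt_agent b' t' hob := by
    have hlt := hC'.past_closed _ _ _ _ hob (by rw [(h.of_mem_moved hb).2]; exact t.lt_succ_self)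
    have htt : t' < t := hob.lt
    rcases h.agent b' with heq | ⟨heq, -⟩ <;> omega

namespace Protocol.IsRun

theorem propCount_le_length_items (hr : P.IsRun r) (hC : r.IsConsistent C) (i : Fin n) :
    r.propCount i (C.agent (.disp i)) ≤ (r.items i (C.agent (.proc i))).length := by
  by_contra! hlt
  obtain ⟨u, -, hu, huk, e, he⟩ := r.exists_prop (s := 0) (by simp [Run.propCount]) hlt
  obtain ⟨it, hit, rfl⟩ := hr.event_disp he
  rw [huk] at hit he
  obtain ⟨w, hwu, hw, hlen⟩ := hr.exists_write hit
  have hwC := hC.past_closed _ _ _ _ (.write_prop i w u _ _ _ _ _ hwu hw he) hu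
  exact hlen.not_ge (r.items_prefix_of_le i hwC).length_le

theorem mem_stateAt_eq (hr : P.IsRun r) (hC : r.IsConsistent C)
    (h : ∀ b u e v, r.event (b, u) = some e → e.memWrite = some (x, v) →
      (u < C.agent b ↔ u < t)) :
    (r.stateAt C).store.mem x = (r.state t).store.mem x := by
  have hiff : ∀ b u e v, r.event (b, u) = some e → e.memWrite = some (x, v) →
      (u < C.mem x ↔ u < t) := fun b u e v he hx =>
    (hC.store_iff b u e x v he hx).trans (h b u e v he hx)
  change (r.state (C.mem x)).store.mem x = _
  rcases le_total (C.mem x) t with hle | hle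
  · refine (hr.mem_eq_of_forall_ne hle fun b u e v hu hut he hx => ?_).symm
    exact hu.not_gt ((hiff b u e v he hx).2 hut)
  · refine hr.mem_eq_of_forall_ne hle fun b u e v hu hut he hx => ?_
    exact hu.not_gt ((hiff b u e v he hx).1 hut)

theorem lt_agent_iff_of_conflict (hr : P.IsRun r) (hC : r.IsConsistent C)
    (hθ : r.IsNext C (b, t)) (he : r.event (b, t) = some e) {c : Agent n} {u : ℕ}
    {f : Event Var Val Lab Resp} (hf : r.event (c, u) = some f) (hfe : Conflict c b f e) :
    u < C.agent c ↔ u < t := by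
  refine ⟨fun hu => ?_, fun hu => hθ.lt_agent c u (.of_conflict hu hf he hfe)⟩
  have hb : C.agent b = t := hθ.agent_eq
  rcases lt_trichotomy u t with hut | rfl | hut
  · exact hut
  · rcases eq_or_ne c b with rfl | hcb
    · exact hu.trans_eq hb
    · exact absurd hfe ((hr.enabled u).noConflict c b f e hcb hf he)
  · exact absurd (hC.past_closed _ _ _ _ (.of_conflict hut he hf hfe.symm) hu) hb.not_gt

theorem event_disp_stateAt (hr : P.IsRun r) (hθ : r.IsNext C (.disp i, t)) :
    eventOf (r.stateAt C) (r.joint t) (.disp i) = r.event (.disp i, t) := by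
  cases hp : (r.joint t).prop i with
  | false => simp [Run.event, eventOf, hp]
  | true =>
    have hsome := eventOf_disp_isSome_iff.2 ⟨hp, (hr.enabled t).prop i hp⟩
    obtain ⟨e, he : r.event (.disp i, t) = some e⟩ := Option.isSome_iff_exists.1 hsome
    obtain ⟨it, hit, rfl⟩ := hr.event_disp he
    obtain ⟨u, hut, hu, hlen⟩ := hr.exists_write hit
    have huC := hθ.lt_agent _ _ (.write_prop i u t _ _ _ _ _ hut hu he)
    have hhead : ((r.stateAt C).store.buf i).head? = some it := by
      have hagent : C.agent (.disp i) = t := hθ.agent_eq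
      change ((r.items i _).drop (r.propCount i (C.agent (.disp i)))).head? = _
      rw [hagent, List.head?_drop, r.items_getElem? huC hlen, ← r.items_getElem? hut hlen, hit]
    rw [he, eventOf, if_pos hp, hhead, Option.map_some, hr.isTagged_items i t _ _ hit]

theorem buf_stateAt_eq_nil (hr : P.IsRun r) (hθ : r.IsNext C (.proc i, t))
    (he : r.event (.proc i, t) = some e) (hsync : e.IsSync)
    (hbuf : (r.state t).store.buf i = []) : (r.stateAt C).store.buf i = [] := by
  have hagent : C.agent (.proc i) = t := hθ.agent_eq
  change (r.items i (C.agent (.proc i))).drop _ = []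
  rw [hr.buf_eq, List.drop_eq_nil_iff] at hbuf
  rw [hagent, List.drop_eq_nil_iff]
  by_contra! hlt
  obtain ⟨u, hCu, hut, -, f, hf⟩ := r.exists_prop le_rfl (hlt.trans_le hbuf)
  obtain ⟨it, -, rfl⟩ := hr.event_disp hf
  exact hCu.not_gt (hθ.lt_agent _ _ (.sync i u t _ _ hut hf trivial he hsync))

theorem propCount_le_idx_of_rfb (hr : P.IsRun r) (hsim : r.NoReadDuringProp)
    (hC : r.IsConsistent C) (hθ : r.IsNext C (.proc i, t)) {k : ℕ}
    (he : r.event (.proc i, t) = some (.rfb x v k)) (hk : r.propCount i t ≤ k) :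
    r.propCount i (C.agent (.disp i)) ≤ k := by
  have hagent : C.agent (.proc i) = t := hθ.agent_eq
  by_contra! hlt
  obtain ⟨u, htu, hu, rfl, f, hf⟩ := r.exists_prop hk hlt
  obtain ⟨it, -, rfl⟩ := hr.event_disp hf
  rcases htu.eq_or_lt with rfl | htu
  · exact hsim i t _ _ _ _ _ ⟨he, hf⟩
  · exact hagent.not_gt (hC.past_closed _ _ _ _ (.rfb_prop i t u _ _ _ _ _ htu he hf) hu)

theorem mem_stateAt_eq_of_rfm (hr : P.IsRun r) (hC : r.IsConsistent C)
    (hθ : r.IsNext C (.proc i, t)) (he : r.event (.proc i, t) = some (.rfm x v))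
    (hnew : ∀ it, newest (r.items i t) x = some it → it.idx < r.propCount i t)
    (hnew' : ∀ it, newest (r.items i t) x = some it →
      it.idx < r.propCount i (C.agent (.disp i))) :
    (r.stateAt C).store.mem x = (r.state t).store.mem x := by
  have hagent : C.agent (.proc i) = t := hθ.agent_eq
  refine hr.mem_stateAt_eq hC fun c u f w hf hx => ?_
  by_cases hc : c = .disp i
  · subst hc
    refine ⟨fun hu => ?_, fun hut => ?_⟩
    · by_contra! htu
      rcases htu.eq_or_lt with rfl | htu
      · obtain ⟨it, hit, hle⟩ := hr.exists_newest_of_event_disp le_rfl hf hx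
        exact hle.not_gt (hnew it hit)
      · have hob : r.OB (.proc i, t) (.disp i, u) :=
          .memory _ _ t u x _ f htu he hf rfl (Event.access_of_memWrite hx)
            (fun h => Event.not_isRfM_of_memWrite hx h.2) (by rintro ⟨j, hj, -⟩; cases hj)
        exact hagent.not_gt (hC.past_closed _ _ _ _ hob hu)
    · by_contra! hu
      obtain ⟨it, hit, hle⟩ := hr.exists_newest_of_event_disp hut.le hf hx
      exact ((r.propCount_mono i hu).trans hle).not_gt (hnew' it hit)
  · exact hr.lt_agent_iff_of_conflict hC hθ he hf (.of_memWrite_of_rfm hx hc)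

theorem val_eq_mem_of_rfm (hr : P.IsRun r) (hC : r.IsConsistent C)
    (hθ : r.IsNext C (.proc i, t)) (he : r.event (.proc i, t) = some (.rfm x v))
    {it : Item Var Val} (hnew : newest (r.items i t) x = some it)
    (hlt : it.idx < r.propCount i t) (hle : r.propCount i (C.agent (.disp i)) ≤ it.idx) :
    it.val = (r.state t).store.mem x := by
  obtain ⟨u, hCu, hut, huk, f, hf⟩ := r.exists_prop hle hlt
  have hu : r.propCount i (u + 1) = it.idx + 1 := by simp [r.propCount_succ, huk, hf]
  have hwrite : f.memWrite = some (x, it.val) := by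
    obtain ⟨it', hit', rfl⟩ := hr.event_disp hf
    obtain ⟨hmem, rfl⟩ := mem_of_newest_eq_some hnew
    obtain ⟨k, hk⟩ := List.mem_iff_getElem?.1 hmem
    obtain rfl := hr.isTagged_items i t k it hk
    rw [huk] at hit'
    rw [← r.items_getElem? hut.le (List.getElem?_eq_some_iff.1 hit').1, hk] at hit'
    cases hit'
    rfl
  rw [← hr.mem_succ hf hwrite]
  -- A later store to `x` would propagate a newer entry of `i`, or would come from another agent
  -- and conflict with both the read and the propagation, placing the latter inside the cut.
  refine (hr.mem_eq_of_forall_ne hut fun c u' f' v' huu' hu't hf' hx => ?_).symm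
  by_cases hc : c = .disp i
  · subst hc
    obtain ⟨it', hit', hle'⟩ := hr.exists_newest_of_event_disp hu't.le hf' hx
    obtain rfl : it = it' := Option.some.inj (hnew.symm.trans hit')
    have : r.propCount i (u + 1) ≤ r.propCount i u' := r.propCount_mono i huu'
    omega
  · have hu'C := hθ.lt_agent _ _ (.of_conflict hu't hf' he (.of_memWrite_of_rfm hx hc))
    have huC := hC.past_closed _ _ _ _ (.of_conflict huu' hf hf' (.of_memWrite hwrite hx)) hu'C
    exact hCu.not_gt huC

theorem procEvent_read_matches (hr : P.IsRun r) (hsim : r.NoReadDuringProp)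
    (hC : r.IsConsistent C) (hθ : r.IsNext C (.proc i, t))
    (hα : (r.joint t).act i = some (.read x)) :
    (procEvent (r.stateAt C) i (.read x)).Matches (procEvent (r.state t) i (.read x)) := by
  have hagent : C.agent (.proc i) = t := hθ.agent_eq
  have htag := hr.isTagged_items i t
  have he : r.event (.proc i, t) = some (procEvent (r.state t) i (.read x)) := by
    simp [Run.event, eventOf, hα]
  have hbuf' : (r.stateAt C).store.buf i =
      (r.items i t).drop (r.propCount i (C.agent (.disp i))) := hagent ▸ rfl
  simp only [procEvent, hr.buf_eq, hbuf', htag.newest_drop] at he ⊢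
  cases hnew : newest (r.items i t) x with
  | none =>
    simp only [hnew, Option.filter_none] at he ⊢
    rw [hr.mem_stateAt_eq_of_rfm hC hθ he (by simp [hnew]) (by simp [hnew])]
    exact .refl _
  | some it =>
    simp only [hnew, Option.filter_some, decide_eq_true_eq] at he ⊢
    split_ifs at he ⊢ with hle hlt hlt
    · exact .refl _
    · rw [← hr.val_eq_mem_of_rfm hC hθ he hnew (not_le.1 hlt) hle]
      exact .rfb_rfm _ _ _
    · exact absurd (hr.propCount_le_idx_of_rfb hsim hC hθ he hlt) hle
    · rw [hr.mem_stateAt_eq_of_rfm hC hθ he (by simpa [hnew] using hlt)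
        (by simpa [hnew] using hle)]
      exact .refl _

theorem actEnabled_stateAt (hr : P.IsRun r) (hC : r.IsConsistent C)
    (hθ : r.IsNext C (.proc i, t)) {α : Act Var Val Lab Resp}
    (hα : (r.joint t).act i = some α) : ActEnabled (r.stateAt C) i α := by
  have hloc : (r.stateAt C).loc i = (r.state t).loc i := by
    rw [← show C.agent (.proc i) = t from hθ.agent_eq]
    rfl
  have hen := (hr.enabled t).act i α hα
  have he : r.event (.proc i, t) = some (procEvent (r.state t) i α) := by
    simp [Run.event, eventOf, hα]
  cases α with
  | fence => exact hr.buf_stateAt_eq_nil hθ he trivial hen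
  | rmw y ve vn =>
    refine ⟨hr.buf_stateAt_eq_nil hθ he trivial hen.1, .trans ?_ hen.2⟩
    exact hr.mem_stateAt_eq hC fun c u f w hf hx =>
      hr.lt_agent_iff_of_conflict hC hθ he hf (.of_memWrite hx rfl)
  | ret ρ => exact (congrArg pending hloc).trans hen
  | _ => trivial

theorem imitates_stateAt (hr : P.IsRun r) (hsim : r.NoReadDuringProp) (hC : r.IsConsistent C)
    (hC' : r.IsConsistent C') (hstep : Cut.Step t C C') :
    Imitates (C.moved C') (r.joint t) (r.state t) (r.stateAt C) where
  loc i hi := by rw [← (hstep.of_mem_moved hi).1]; rfl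
  act i α hi hα := hr.actEnabled_stateAt hC (hC'.isNext hstep hi) hα
  event b hb := by
    have hθ := hC'.isNext hstep hb
    cases b with
    | disp i =>
      rw [hr.event_disp_stateAt hθ, Run.event]
      cases eventOf (r.state t) (r.joint t) (.disp i) with
      | none => exact .none
      | some e => exact .some (.refl e)
    | proc i =>
      cases hα : (r.joint t).act i with
      | none => simp only [eventOf, hα]; exact .none
      | some α =>
        simp only [eventOf, hα]
        refine .some ?_
        cases α with
        | read x => exact hr.procEvent_read_matches hsim hC hθ hα
        | write x v =>
          have hloc : (r.stateAt C).loc i = (r.state t).loc i := by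
            rw [← show C.agent (.proc i) = t from hθ.agent_eq]
            rfl
          rw [procEvent, hloc]
          exact .refl _
        | _ => exact .refl _

theorem next_stateAt_buf (hr : P.IsRun r) (hC : r.IsConsistent C) (hstep : Cut.Step t C C')
    (him : Imitates (C.moved C') (r.joint t) (r.state t) (r.stateAt C)) (i : Fin n) :
    (next (r.stateAt C) ((r.joint t).restrict (C.moved C'))).store.buf i =
      (r.stateAt C').store.buf i := by
  have hitems : r.items i (C.agent (.proc i)) ++
      (eventOf (r.stateAt C) ((r.joint t).restrict (C.moved C')) (.proc i)).elim [] Event.written =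
        r.items i (C'.agent (.proc i)) := by
    by_cases hi : .proc i ∈ C.moved C'
    · rw [him.elim_eq hi [] fun _ _ => Event.Matches.written_eq, (hstep.of_mem_moved hi).1,
        (hstep.of_mem_moved hi).2]
      rfl
    · rw [eventOf_restrict_of_notMem hi, hstep.of_notMem_moved hi, Option.elim_none,
        List.append_nil]
  have hcount : r.propCount i (C.agent (.disp i)) +
      (if (eventOf (r.stateAt C) ((r.joint t).restrict (C.moved C')) (.disp i)).isSome
        then 1 else 0) = r.propCount i (C'.agent (.disp i)) := by
    by_cases hi : .disp i ∈ C.moved C'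
    · rw [him.isSome_eq hi, (hstep.of_mem_moved hi).1, (hstep.of_mem_moved hi).2,
        r.propCount_succ]
      rfl
    · rw [eventOf_restrict_of_notMem hi, hstep.of_notMem_moved hi]
      rfl
  rw [next_buf_eq_drop rfl (hr.propCount_le_length_items hC i), hitems, hcount]
  rfl

theorem next_stateAt_mem (hr : P.IsRun r) (hC : r.IsConsistent C) (hC' : r.IsConsistent C')
    (hstep : Cut.Step t C C')
    (him : Imitates (C.moved C') (r.joint t) (r.state t) (r.stateAt C)) (x : Var) :
    (next (r.stateAt C) ((r.joint t).restrict (C.moved C'))).store.mem x =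
      (r.stateAt C').store.mem x := by
  change _ = (r.state (C'.mem x)).store.mem x
  rcases hstep.mem x with heq | ⟨heq, heq'⟩
  · rw [him.next_mem_of_notMem fun b e v he hx hb => ?_, heq]
    · rfl
    · have hiff := hC.store_iff b t e x v he hx
      have hiff' := hC'.store_iff b t e x v he hx
      have := hstep.of_mem_moved hb
      omega
  · rw [heq', hr.state_succ]
    refine him.next_mem (hr.enabled t) (by rw [← heq]; rfl) fun b e v he hx => ?_
    have hiff := hC.store_iff b t e x v he hx
    have hiff' := hC'.store_iff b t e x v he hx
    change C.agent b < C'.agent b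
    omega

theorem next_stateAt (hr : P.IsRun r) (hsim : r.NoReadDuringProp) (hC : r.IsConsistent C)
    (hC' : r.IsConsistent C') (hstep : Cut.Step t C C') :
    next (r.stateAt C) ((r.joint t).restrict (C.moved C')) = r.stateAt C' := by
  have him := hr.imitates_stateAt hsim hC hC' hstep
  have hmem := funext (hr.next_stateAt_mem hC hC' hstep him)
  have hbuf := funext (hr.next_stateAt_buf hC hstep him)
  have hloc : (next (r.stateAt C) ((r.joint t).restrict (C.moved C'))).loc =
      (r.stateAt C').loc := by
    funext i
    change _ = (r.state (C'.agent (.proc i))).loc i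
    by_cases hi : .proc i ∈ C.moved C'
    · rw [him.next_loc hi, (hstep.of_mem_moved hi).2, hr.state_succ]
    · rw [next_restrict_loc_of_notMem hi, hstep.of_notMem_moved hi]
      rfl
  generalize next (r.stateAt C) ((r.joint t).restrict (C.moved C')) = g at hmem hbuf hloc
  generalize r.stateAt C' = g' at hmem hbuf hloc
  obtain ⟨⟨mem, buf⟩, loc⟩ := g
  obtain ⟨⟨mem', buf'⟩, loc'⟩ := g'
  simp_all

end Protocol.IsRun

/-- The run that passes through the cuts `C 0, C 1, …` of `r`, performing between `C s` and
`C (s + 1)` the corresponding part of round `round s` of `r`. -/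
noncomputable def Run.reschedule (r : Run n Var Val Lab Op Resp) (C : ℕ → Cut n Var)
    (round : ℕ → ℕ) : Run n Var Val Lab Op Resp where
  state s := r.stateAt (C s)
  joint s := (r.joint (round s)).restrict ((C s).moved (C (s + 1)))

theorem Protocol.IsRun.reschedule (hr : P.IsRun r) (hsim : r.NoReadDuringProp)
    {C : ℕ → Cut n Var} {round : ℕ → ℕ} (hzero : C 0 = ⟨fun _ => 0, fun _ => 0⟩)
    (hC : ∀ s, r.IsConsistent (C s)) (hstep : ∀ s, Cut.Step (round s) (C s) (C (s + 1))) :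
    P.IsRun (r.reschedule C round) where
  mem_zero := by
    rw [← hr.mem_zero]
    simp only [Run.reschedule, hzero, Run.stateAt]
  buf_zero i := by simp [Run.reschedule, hzero, Run.stateAt, Run.items]
  loc_zero i := by
    rw [← hr.loc_zero i]
    simp only [Run.reschedule, hzero, Run.stateAt]
  enabled s := (hr.imitates_stateAt hsim (hC s) (hC (s + 1)) (hstep s)).enabled_restrict
    (hr.enabled (round s))
  state_succ s := (hr.next_stateAt hsim (hC s) (hC (s + 1)) (hstep s)).symm
  follows s i α hα := by
    obtain ⟨hi, hα⟩ := JointAction.restrict_act_eq_some_iff.1 hα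
    have hloc := (hr.imitates_stateAt hsim (hC s) (hC (s + 1)) (hstep s)).loc i hi
    exact hloc ▸ hr.follows (round s) i α hα

end Cuts

section Delay

/-- The number of rounds completed at time `s` by an agent that performs its first `p` rounds on
schedule and postpones all later rounds by `D`. -/
def delayedProgress (D p s : ℕ) : ℕ :=
  if s < D then min s p else max (s - D) p

/-- The original round that is performed, in part, at time `s` when some of the rounds are
postponed by `D`. -/
def delayedRound (D s : ℕ) : ℕ :=
  if s < D then s else s - D

/-- The time at which an agent performs its round `t` if it postpones all but its first `p` rounds
by `D`. -/
def delayedTime (D p t : ℕ) : ℕ :=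
  if t < p then t else D + t

theorem delayedProgress_zero {D p : ℕ} (h : p ≤ D) : delayedProgress D p 0 = 0 := by
  grind [delayedProgress]

theorem delayedProgress_succ {D p : ℕ} (h : p ≤ D) (s : ℕ) :
    delayedProgress D p (s + 1) = delayedProgress D p s ∨
      delayedProgress D p s = delayedRound D s ∧
        delayedProgress D p (s + 1) = delayedRound D s + 1 := by
  grind [delayedProgress, delayedRound]

theorem delayedTime_eq_iff {D p : ℕ} (h : p ≤ D) {s t : ℕ} :
    delayedTime D p t = s ↔
      delayedProgress D p s < delayedProgress D p (s + 1) ∧ delayedRound D s = t := by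
  grind [delayedProgress, delayedRound, delayedTime]

theorem strictMono_delayedTime (D p : ℕ) : StrictMono (delayedTime D p) := by
  intro t t' h
  grind [delayedTime]

/-- The cut reached at time `s` if the nodes inside `C` are performed on schedule and all other
nodes are postponed by `D`. -/
def Cut.delay {n : ℕ} {Var : Type*} (C : Cut n Var) (D s : ℕ) : Cut n Var where
  agent b := delayedProgress D (C.agent b) s
  mem x := delayedProgress D (C.mem x) s

/-- `r'` consists of the same process actions and invocations as `r`, those of round `t` of
process `i` taking place at time `τ i t`. -/
structure Run.IsRetiming {n : ℕ} {Var Val Lab Op Resp : Type*}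
    (r r' : Run n Var Val Lab Op Resp) (τ : Fin n → ℕ → ℕ) : Prop where
  strictMono : ∀ i, StrictMono (τ i)
  act_iff : ∀ s i α, (r'.joint s).act i = some α ↔ ∃ t, τ i t = s ∧ (r.joint t).act i = some α
  inv_iff : ∀ s i o, (r'.joint s).inv i = some o ↔ ∃ t, τ i t = s ∧ (r.joint t).inv i = some o

/-- The operation that corresponds to `X` after retiming a run by `τ`. -/
def OpId.retime {n : ℕ} (τ : Fin n → ℕ → ℕ) (X : OpId n) : OpId n :=
  ⟨X.proc, τ X.proc X.start⟩

namespace Run.IsRetiming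

variable {n : ℕ} {Var Val Lab Op Resp W : Type*} {r r' : Run n Var Val Lab Op Resp}
  {τ : Fin n → ℕ → ℕ} {X : OpId n}

theorem isOp (h : r.IsRetiming r' τ) {o : Op} (hX : r.IsOp X o) : r'.IsOp (X.retime τ) o :=
  (h.inv_iff _ _ _).2 ⟨X.start, rfl, hX⟩

theorem endsWith (h : r.IsRetiming r' τ) {u : ℕ} {ρ : Resp} (hX : r.EndsWith X (u + 1) ρ) :
    r'.EndsWith (X.retime τ) (τ X.proc u + 1) ρ := by
  obtain ⟨⟨o, ho⟩, u', hu, hXu, hρ, hfirst⟩ := hX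
  obtain rfl : u = u' := Nat.succ.inj hu
  refine ⟨⟨o, h.isOp ho⟩, _, rfl, h.strictMono _ hXu, (h.act_iff _ _ _).2 ⟨u, rfl, hρ⟩, ?_⟩
  intro s ρ' hs hsu hret
  obtain ⟨w, rfl, hw⟩ := (h.act_iff _ _ _).1 hret
  exact hfirst w ρ' ((h.strictMono _).lt_iff_lt.1 hs) ((h.strictMono _).lt_iff_lt.1 hsu) hw

theorem distinctUpdates {r r' : Run n Var Val Lab (SnapOp W) Resp} (h : r.IsRetiming r' τ)
    (hr : r.DistinctUpdates) : r'.DistinctUpdates := by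
  rintro ⟨i, s⟩ ⟨j, s'⟩ w (rfl : i = j) hX hY
  obtain ⟨t, ht : τ i t = s, hX⟩ := (h.inv_iff _ _ _).1 hX
  obtain ⟨t', ht' : τ i t' = s', hY⟩ := (h.inv_iff _ _ _).1 hY
  have htt : t = t' := hr ⟨i, t⟩ ⟨i, t'⟩ w rfl hX hY
  exact ht.symm.trans (htt ▸ ht')

end Run.IsRetiming

variable {n : ℕ} {Var Val Lab Op Resp : Type*}

theorem Run.isRetiming_reschedule_delay [DecidableEq Var] (r : Run n Var Val Lab Op Resp)
    {C : Cut n Var} {D : ℕ} (hD : ∀ i, C.agent (.proc i) ≤ D) :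
    r.IsRetiming (r.reschedule (C.delay D) (delayedRound D))
      fun i => delayedTime D (C.agent (.proc i)) where
  strictMono i := strictMono_delayedTime D _
  act_iff s i α := by
    simp only [delayedTime_eq_iff (hD i), and_assoc, exists_and_left, exists_eq_left']
    exact JointAction.restrict_act_eq_some_iff
  inv_iff s i o := by
    simp only [delayedTime_eq_iff (hD i), and_assoc, exists_and_left, exists_eq_left']
    exact JointAction.restrict_inv_eq_some_iff

variable [DecidableEq Var] {P : Protocol n Var Val Lab Op Resp} {r : Run n Var Val Lab Op Resp}
  {C : Cut n Var} {θ : Node n} {b : Agent n} {t : ℕ}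

theorem Run.IsConsistent.delay (hC : r.IsConsistent C) (D s : ℕ) :
    r.IsConsistent (C.delay D s) where
  past_closed b t b' t' hob := by
    have hclosed := hC.past_closed b t b' t' hob
    have htt : t < t' := hob.lt
    grind [Cut.delay, delayedProgress]
  store_iff b t e x v he hx := by
    have hiff := hC.store_iff b t e x v he hx
    grind [Cut.delay, delayedProgress]

theorem Protocol.IsRun.reschedule_delay (hr : P.IsRun r) (hsim : r.NoReadDuringProp)
    (hC : r.IsConsistent C) {D : ℕ} (hagent : ∀ b, C.agent b ≤ D) (hmem : ∀ x, C.mem x ≤ D) :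
    P.IsRun (r.reschedule (C.delay D) (delayedRound D)) := by
  refine hr.reschedule hsim ?_ (hC.delay D) fun s =>
    ⟨fun b => delayedProgress_succ (hagent b) s, fun x => delayedProgress_succ (hmem x) s⟩
  ext
  exacts [delayedProgress_zero (hagent _), delayedProgress_zero (hmem _)]

/-- The past of the node `θ`. -/
noncomputable def Run.pastCut (r : Run n Var Val Lab Op Resp) (θ : Node n) : Cut n Var where
  agent b := sSup (Nat.succ '' {t | r.OB (b, t) θ})
  mem x := sSup (Nat.succ '' {t | ∃ b e v,
    r.event (b, t) = some e ∧ e.memWrite = some (x, v) ∧ r.OB (b, t) θ})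

theorem lt_sSup_succ_image_iff {S : Set ℕ} {B : ℕ} (hS : ∀ u ∈ S, u < B) :
    t < sSup (Nat.succ '' S) ↔ ∃ u ∈ S, t ≤ u := by
  rw [lt_csSup_iff' ⟨B, Set.forall_mem_image.2 hS⟩]
  simp

theorem Run.lt_pastCut_agent_iff : t < (r.pastCut θ).agent b ↔ r.OB (b, t) θ := by
  refine (lt_sSup_succ_image_iff fun u (hu : r.OB (b, u) θ) => hu.lt).trans
    ⟨fun ⟨u, hu, htu⟩ => ?_, fun h => ⟨t, h, le_rfl⟩⟩
  rcases htu.eq_or_lt with rfl | htu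
  exacts [hu, .trans _ _ _ (.locality b t u htu) hu]

theorem Run.lt_pastCut_mem_iff {x : Var} : t < (r.pastCut θ).mem x ↔
    ∃ u ≥ t, ∃ b e v,
      r.event (b, u) = some e ∧ e.memWrite = some (x, v) ∧ r.OB (b, u) θ := by
  refine (lt_sSup_succ_image_iff (B := θ.2) ?_).trans (exists_congr fun u => And.comm)
  rintro u ⟨b, e, v, -, -, hob⟩
  exact hob.lt

theorem Run.pastCut_agent_le : (r.pastCut θ).agent b ≤ θ.2 :=
  csSup_le' (Set.forall_mem_image.2 fun _ ht => (show r.OB _ θ from ht).lt)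

theorem Run.pastCut_mem_le {x : Var} : (r.pastCut θ).mem x ≤ θ.2 :=
  csSup_le' (Set.forall_mem_image.2 fun _ ⟨_, _, _, _, _, hob⟩ => hob.lt)

theorem Protocol.IsRun.isConsistent_pastCut (hr : P.IsRun r) (θ : Node n) :
    r.IsConsistent (r.pastCut θ) where
  past_closed b t b' t' hob ht' :=
    Run.lt_pastCut_agent_iff.2 (.trans _ _ _ hob (Run.lt_pastCut_agent_iff.1 ht'))
  store_iff b t e x v he hx := by
    rw [Run.lt_pastCut_agent_iff, Run.lt_pastCut_mem_iff]
    refine ⟨fun ⟨u, htu, c, f, w, hf, hx', hob⟩ => ?_, fun hob => ⟨t, le_rfl, b, e, v, he, hx, hob⟩⟩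
    rcases eq_or_lt_of_le htu with rfl | htu
    · obtain rfl : b = c := (hr.enabled t).eq_of_memWrite he hf hx hx'
      exact hob
    · exact .trans _ _ _ (.of_conflict htu he hf (.of_memWrite hx hx')) hob

theorem Protocol.IsRun.exists_retiming_precedes (hr : P.IsRun r) (hsim : r.NoReadDuringProp)
    {X Y : OpId n} {o : Op} {e : ℕ} {ρ : Resp} (hX : r.IsOp X o) (hY : r.EndsWith Y e ρ)
    (hob : ¬ r.OB (.proc X.proc, X.start) (.proc Y.proc, e)) :
    ∃ r' τ, P.IsRun r' ∧ r.IsRetiming r' τ ∧ r'.Precedes (Y.retime τ) (X.retime τ) := by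
  obtain ⟨u, rfl, -⟩ := hY.2
  set C := r.pastCut (.proc Y.proc, u + 1)
  have hagent (b) : C.agent b ≤ u + 2 := Run.pastCut_agent_le.trans (Nat.le_succ _)
  have hmem (x) : C.mem x ≤ u + 2 := Run.pastCut_mem_le.trans (Nat.le_succ _)
  have hτ := r.isRetiming_reschedule_delay fun i => hagent (.proc i)
  refine ⟨_, _, hr.reschedule_delay hsim (hr.isConsistent_pastCut _) hagent hmem, hτ,
    ⟨o, hτ.isOp hX⟩, _, ρ, hτ.endsWith hY, ?_⟩
  have hu : u < C.agent (.proc Y.proc) :=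
    Run.lt_pastCut_agent_iff.2 (.locality _ _ _ u.lt_succ_self)
  have hXC : ¬ X.start < C.agent (.proc X.proc) := Run.lt_pastCut_agent_iff.not.2 hob
  simp only [OpId.retime, delayedTime, if_pos hu, if_neg hXC]
  omega

end Delay

section Snapshot

variable {n : ℕ} {Var Val Lab Op Resp W : Type*}

theorem Run.IsOp.unique {r : Run n Var Val Lab Op Resp} {X : OpId n} {o o' : Op}
    (ho : r.IsOp X o) (ho' : r.IsOp X o') : o = o' :=
  Option.some.inj (ho.symm.trans ho')

/-- The step of a sequential history that an entry of a linearization contributes. -/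
def LinEntry.toStep (a : LinEntry n Op Resp) : Fin n × Op × Resp :=
  (a.id.proc, a.op, a.resp)

variable {l : List (LinEntry n (SnapOp W) (SnapResp n W))}
  {a : LinEntry n (SnapOp W) (SnapResp n W)} {k : Fin n} {w : W}

theorem lastUpdate_concat_of_update (hk : a.id.proc = k) (hw : a.op = .update w) :
    lastUpdate ((l ++ [a]).map LinEntry.toStep) k = some w := by
  simp [lastUpdate, LinEntry.toStep, List.filterMap_append, hk, hw]

theorem lastUpdate_concat_of_not_update (h : ¬ (a.id.proc = k ∧ ∃ w, a.op = .update w)) :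
    lastUpdate ((l ++ [a]).map LinEntry.toStep) k = lastUpdate (l.map LinEntry.toStep) k := by
  obtain ⟨id, op, resp⟩ := a
  cases op <;> simp_all [lastUpdate, LinEntry.toStep, List.filterMap_append]

theorem exists_update_of_lastUpdate_eq_some (h : lastUpdate (l.map LinEntry.toStep) k = some w) :
    ∃ a ∈ l, a.id.proc = k ∧ a.op = .update w := by
  have hmem := List.mem_of_getLast? h
  simp only [List.mem_filterMap, List.mem_map] at hmem
  obtain ⟨_, ⟨a, ha, rfl⟩, haw⟩ := hmem
  refine ⟨a, ha, ?_⟩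
  obtain ⟨id, op, resp⟩ := a
  cases op <;> simp_all [LinEntry.toStep]

theorem exists_lastUpdate_eq_some
    (hl : l.Pairwise fun a b => a.id.proc = b.id.proc → a.id.start < b.id.start)
    (ha : a ∈ l) {v : W} (hv : a.op = .update v) :
    ∃ b ∈ l, ∃ w, lastUpdate (l.map LinEntry.toStep) a.id.proc = some w ∧
      b.id.proc = a.id.proc ∧ b.op = .update w ∧ a.id.start ≤ b.id.start := by
  induction l using List.reverseRecOn with
  | nil => cases ha
  | append_singleton l c ih =>
    rw [List.pairwise_append] at hl
    rw [List.mem_append, List.mem_singleton] at ha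
    by_cases hc : c.id.proc = a.id.proc ∧ ∃ w, c.op = .update w
    · obtain ⟨hproc, w, hw⟩ := hc
      refine ⟨c, by simp, w, lastUpdate_concat_of_update hproc hw, hproc, hw, ?_⟩
      rcases ha with ha | rfl
      exacts [(hl.2.2 a ha c (by simp) hproc.symm).le, le_rfl]
    · have hal : a ∈ l := ha.resolve_right fun hac => hc (hac ▸ ⟨rfl, v, hv⟩)
      obtain ⟨b, hb, w, hlast, hbw⟩ := ih hl.1 hal
      exact ⟨b, by simp [hb], w, (lastUpdate_concat_of_not_update hc).trans hlast, hbw⟩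

theorem Run.LinearizableUpTo.exists_prefix_of_scan
    {r : Run n Var Val Lab (SnapOp W) (SnapResp n W)} {T e : ℕ} {X : OpId n} {ρ : SnapResp n W}
    (hlin : r.LinearizableUpTo (snapshotSpec n W) T) (hX : r.IsOp X .scan)
    (he : r.EndsWith X e ρ) (heT : e ≤ T) :
    ∃ l : List (LinEntry n (SnapOp W) (SnapResp n W)),
      ρ = .view (lastUpdate (l.map LinEntry.toStep)) ∧
      l.Pairwise (fun a b => a.id.proc = b.id.proc → a.id.start < b.id.start) ∧
      (∀ a ∈ l, r.IsOp a.id a.op ∧ ¬ r.Precedes X a.id) ∧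
      ∀ Y, r.Precedes Y X → ∃ a ∈ l, a.id = Y := by
  obtain ⟨L, hop, hresp, hcompl, -, horder, hprec, hspec⟩ := hlin
  obtain ⟨a, ha, rfl⟩ := hcompl X e ρ he heT
  obtain ⟨l, l', rfl⟩ := List.append_of_mem ha
  rw [List.pairwise_append] at horder hprec
  have hview := hspec (l.map LinEntry.toStep) (l'.map LinEntry.toStep) a.id.proc a.op a.resp
    (List.map_append ..)
  rw [(hop a ha).2.unique hX] at hview
  refine ⟨l, (hresp a ha e ρ he heT).symm.trans hview, horder.1, fun b hb =>
    ⟨(hop b (List.mem_append_left _ hb)).2, hprec.2.2 b hb a List.mem_cons_self⟩, ?_⟩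
  intro Y hYX
  obtain ⟨-, e', ρ', hY, hlt⟩ := id hYX
  have hle : e' ≤ T := by
    obtain ⟨-, u, rfl, hu, -⟩ := he
    omega
  obtain ⟨y, hy, rfl⟩ := hcompl Y e' ρ' hY hle
  refine ⟨y, ?_, rfl⟩
  rcases List.mem_append.1 hy with hy | hy
  · exact hy
  rcases List.mem_cons.1 hy with rfl | hy
  · obtain ⟨-, u, rfl, hu, -⟩ := hY
    omega
  · exact absurd hYX ((List.pairwise_cons.1 hprec.2.1).1 y hy)

variable {r r' : Run n Var Val Lab (SnapOp W) (SnapResp n W)} {X X' Y : OpId n}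
  {ρ : SnapResp n W}

theorem Run.exists_update_of_scan_eq (hlin : ∀ T, r.LinearizableUpTo (snapshotSpec n W) T)
    (hlin' : ∀ T, r'.LinearizableUpTo (snapshotSpec n W) T) (hX : r.IsOp X .scan)
    (hX' : r'.IsOp X' .scan) {e e' : ℕ} (he : r.EndsWith X e ρ) (he' : r'.EndsWith X' e' ρ)
    {v : W} (hY : r.IsOp Y (.update v)) (hYX : r.Precedes Y X) :
    ∃ w Z Z', r.IsOp Z (.update w) ∧ r'.IsOp Z' (.update w) ∧ Z.proc = Y.proc ∧
      Z'.proc = Y.proc ∧ Y.start ≤ Z.start ∧ ¬ r'.Precedes X' Z' := by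
  obtain ⟨l, rfl, horder, hop, hmem⟩ := (hlin e).exists_prefix_of_scan hX he le_rfl
  obtain ⟨l', hview, -, hop', -⟩ := (hlin' e').exists_prefix_of_scan hX' he' le_rfl
  obtain ⟨y, hy, rfl⟩ := hmem Y hYX
  obtain ⟨z, hz, w, hlast, hzproc, hzw, hle⟩ :=
    exists_lastUpdate_eq_some horder hy ((hop y hy).1.unique hY)
  rw [SnapResp.view.inj hview] at hlast
  obtain ⟨z', hz', hzproc', hzw'⟩ := exists_update_of_lastUpdate_eq_some hlast
  exact ⟨w, z.id, z'.id, hzw ▸ (hop z hz).1, hzw' ▸ (hop' z' hz').1, hzproc, hzproc', hle,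
    (hop' z' hz').2⟩

theorem Run.Precedes.mono_right {r : Run n Var Val Lab Op Resp} {X Y Z : OpId n} {o : Op}
    (h : r.Precedes X Y) (hZ : r.IsOp Z o) (hle : Y.start ≤ Z.start) : r.Precedes X Z := by
  obtain ⟨-, e, ρ, he, hlt⟩ := h
  exact ⟨⟨o, hZ⟩, e, ρ, he, hlt.trans_le hle⟩

theorem Run.DistinctUpdates.eq {r : Run n Var Val Lab (SnapOp W) Resp} {X Y : OpId n}
    (h : r.DistinctUpdates) (hproc : X.proc = Y.proc) (hX : r.IsOp X (.update w))
    (hY : r.IsOp Y (.update w)) : X = Y := by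
  have hstart := h X Y w hproc hX hY
  cases X
  cases Y
  simp_all

namespace Run.IsRetiming

variable {τ : Fin n → ℕ → ℕ} {v : W}

theorem not_precedes_of_update_precedes_scan (h : r.IsRetiming r' τ) (hdist : r.DistinctUpdates)
    (hlin : ∀ T, r.LinearizableUpTo (snapshotSpec n W) T)
    (hlin' : ∀ T, r'.LinearizableUpTo (snapshotSpec n W) T) (hX : r.IsOp X .scan)
    (hY : r.IsOp Y (.update v)) (hYX : r.Precedes Y X) (hcompl : r.Completes X) :
    ¬ r'.Precedes (X.retime τ) (Y.retime τ) := by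
  intro hXY
  obtain ⟨_, ρ, he⟩ := hcompl
  obtain ⟨u, rfl, -⟩ := he.2
  obtain ⟨w, Z, Z', hZ, hZ', hproc, hproc', hle, hnot⟩ :=
    exists_update_of_scan_eq hlin hlin' hX (h.isOp hX) he (h.endsWith he) hY hYX
  obtain rfl : Z' = Z.retime τ :=
    (h.distinctUpdates hdist).eq (hproc'.trans hproc.symm) hZ' (h.isOp hZ)
  refine hnot (hXY.mono_right hZ' ?_)
  simp only [OpId.retime, hproc]
  exact (h.strictMono _).monotone hle

theorem not_precedes_of_scan_precedes_update (h : r.IsRetiming r' τ) (hdist : r.DistinctUpdates)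
    (hlin : ∀ T, r.LinearizableUpTo (snapshotSpec n W) T)
    (hlin' : ∀ T, r'.LinearizableUpTo (snapshotSpec n W) T) (hX : r.IsOp X .scan)
    (hY : r.IsOp Y (.update v)) (hXY : r.Precedes X Y) :
    ¬ r'.Precedes (Y.retime τ) (X.retime τ) := by
  intro hYX
  obtain ⟨-, _, ρ, he, -⟩ := id hXY
  obtain ⟨u, rfl, -⟩ := he.2
  obtain ⟨w, Z', Z, hZ', hZ, hproc', hproc, hle, hnot⟩ :=
    exists_update_of_scan_eq hlin' hlin (h.isOp hX) hX (h.endsWith he) he (h.isOp hY) hYX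
  obtain rfl : Z' = Z.retime τ :=
    (h.distinctUpdates hdist).eq (hproc'.trans hproc.symm) hZ' (h.isOp hZ)
  refine hnot (hXY.mono_right hZ ?_)
  simp only [OpId.retime, hproc] at hle
  exact (h.strictMono _).le_iff_le.1 hle

end Run.IsRetiming

end Snapshot
end TSO

theorem mainTheorem7 {n : ℕ} {Var Val Lab W : Type*} [DecidableEq Var]
    (P : TSO.Protocol n Var Val Lab (TSO.SnapOp W) (TSO.SnapResp n W))
    (hP : P.IsLinearizableSnapshot)
    (r : TSO.Run n Var Val Lab (TSO.SnapOp W) (TSO.SnapResp n W))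
    (hr : P.IsRun r) (hdistinct : r.DistinctUpdates) (hsim : r.NoReadDuringProp) :
    (∀ (X Y : TSO.OpId n) (v : W), r.IsOp X (.update v) → r.IsOp Y .scan →
      r.Precedes X Y → r.Completes Y → r.OpOB X Y) ∧
    (∀ (X Y : TSO.OpId n) (v : W), r.IsOp X .scan → r.IsOp Y (.update v) →
      r.Precedes X Y → r.Completes Y → r.OpOB X Y) := by
  have hlin := hP r hr hdistinct
  refine ⟨fun X Y v hX hY hXY hcompl => ?_, fun X Y v hX hY hXY ⟨e, ρ, he⟩ => ?_⟩
  · obtain ⟨e, ρ, he⟩ := id hcompl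
    refine ⟨⟨_, hX⟩, e, ρ, he, ?_⟩
    by_contra hob
    obtain ⟨r', τ, hr', hτ, hYX⟩ := hr.exists_retiming_precedes hsim hX he hob
    have hlin' := hP r' hr' (hτ.distinctUpdates hdistinct)
    exact hτ.not_precedes_of_update_precedes_scan hdistinct hlin hlin' hY hX hXY hcompl hYX
  · refine ⟨⟨_, hX⟩, e, ρ, he, ?_⟩
    by_contra hob
    obtain ⟨r', τ, hr', hτ, hYX⟩ := hr.exists_retiming_precedes hsim hX he hob
    have hlin' := hP r' hr' (hτ.distinctUpdates hdistinct)
    exact hτ.not_precedes_of_scan_precedes_update hdistinct hlin hlin' hX hY hXY hYX
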